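/- Let $c\ge 3$ and $n\ge 4$ be integers. A $c$-edge-colored multigraph is a finite loopless multigraph in which every edge has one of $c$ colors and no two edges joining the same pair of vertices have the same color. The rainbow degree of a vertex is the number of different colors on the edges incident to it, and the rainbow degree $rd(G)$ of a multigraph $G$ is the minimum of the rainbow degrees of its vertices. A proper Hamiltonian cycle is a cycle that contains all vertices and in which any two adjacent edges have different colors. 1. Let $G$ be a $c$-edge-colored multigraph on $n$ vertices with $m$ edges. If $rd(G)=c$ and $m\ge c\binom{n-1}{2}+c+1$, then $G$ has a proper Hamiltonian cycle. 2. The bound on $m$ is tight: for all $n\ge 4$ and $c\ge 3$ there is a connected $c$-edge-colored multigraph on $n$ vertices with rainbow degree $c$ and exactly $c\binom{n-1}{2}+c$ edges that has no proper Hamiltonian cycle. -/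

import Mathlib

/-- A `c`-edge-colored multigraph with vertex set `V` and set of colors `Fin c`: every edge has
two distinct ends and one color, and no two edges joining the same pair of vertices have the same
color. An edge is therefore determined by its unordered pair of ends together with its color. -/
structure EdgeColoredMultigraph (V : Type*) (c : ℕ) where
  /-- The edges; `(s(x, y), i)` is the edge of color `i` joining `x` and `y`. -/
  edgeSet : Set (Sym2 V × Fin c)
  /-- There are no loops. -/
  loopless : ∀ e ∈ edgeSet, ¬ e.1.IsDiag

namespace EdgeColoredMultigraph

variable {V : Type*} {c : ℕ}

/-- The number of edges (parallel edges of different colors are counted separately). -/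
noncomputable def numEdges (G : EdgeColoredMultigraph V c) : ℕ :=
  G.edgeSet.ncard

/-- The set of the colors of the edges incident to `x`. -/
def colorsAt (G : EdgeColoredMultigraph V c) (x : V) : Set (Fin c) :=
  {i | ∃ e ∈ G.edgeSet, x ∈ e.1 ∧ e.2 = i}

/-- The rainbow degree of the vertex `x`: the number of different colors on the edges
incident to `x`. -/
noncomputable def vertexRainbowDegree (G : EdgeColoredMultigraph V c) (x : V) : ℕ :=
  (G.colorsAt x).ncard

/-- The rainbow degree of `G`: the minimum of the rainbow degrees of its vertices. -/
noncomputable def rainbowDegree (G : EdgeColoredMultigraph V c) : ℕ :=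
  ⨅ x : V, G.vertexRainbowDegree x

/-- The simple graph that joins two vertices when some edge of `G`, of any color, joins them. -/
def underlying (G : EdgeColoredMultigraph V c) : SimpleGraph V where
  Adj x y := ∃ i, (s(x, y), i) ∈ G.edgeSet
  symm := ⟨fun x y ⟨i, hi⟩ => ⟨i, by rwa [Sym2.eq_swap]⟩⟩
  loopless := ⟨fun x ⟨_, hi⟩ => G.loopless _ hi (Sym2.mk_isDiag_iff.2 rfl)⟩

/-- `G` is connected. -/
def Connected (G : EdgeColoredMultigraph V c) : Prop :=
  G.underlying.Connected

/-- A set of colored edges is properly colored if any two distinct edges in it that share an end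
differ in color. -/
def IsProper (H : Set (Sym2 V × Fin c)) : Prop :=
  ∀ e ∈ H, ∀ f ∈ H, e ≠ f → (∃ x, x ∈ e.1 ∧ x ∈ f.1) → e.2 ≠ f.2

/-- `G` has a proper Hamiltonian cycle: its vertices can be arranged in a cyclic sequence
`v 0, v 1, …, v (n - 1)` without repetition (`n ≥ 3`, indices modulo `n`), and each `v i` can be
joined to `v (i + 1)` by an edge of `G`, of color `col i`, such that the chosen edges are properly
colored. -/
def HasProperHamiltonianCycle [Fintype V] (G : EdgeColoredMultigraph V c) : Prop :=
  3 ≤ Fintype.card V ∧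
    ∃ (v : ZMod (Fintype.card V) → V) (col : ZMod (Fintype.card V) → Fin c),
      Function.Bijective v ∧
      (∀ i, (s(v i, v (i + 1)), col i) ∈ G.edgeSet) ∧
      IsProper (Set.range fun i => (s(v i, v (i + 1)), col i))

end EdgeColoredMultigraph

/-! Let `n` be the number of vertices. Since `n.choose 2 - (n - 1).choose 2 = n - 1`, fewer than `c
* (n - 2)` colored edges are missing from the complete multigraph. By averaging, some three colors
`i`, `j`, `l` together miss at most `3 * n - 7` edges; let `i` be the one that misses fewest, at
most `n - 3`. The colors `j` and `l` are used to cut the vertex set into `n / 2` short paths: pairs,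
and one triple if `n` is odd (`exists_isTiling`). This works by removing a vertex of maximum missing
degree with a suitable partner; a vertex separated from all others in both colors is the
obstruction, and the rainbow degree excludes it. The paths are then oriented and linked cyclically
by edges of color `i`, so links and path edges never clash. By `exists_cyclic_arrangement`, `k`
paths can be linked if at most `2 * k - 3` links are missing. For even `n` this allows `n - 3`
missing edges, as needed, but for odd `n` only `n - 4`. If `n` is odd and `i` misses exactly `n - 3`
edges, then `j` and `l` miss at most `2 * n - 4`, and `exists_isTiling_isHidden` finds a tiling for
which one given missing edge of color `i` is never a possible link. For tightness, a vertex is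
joined to a single neighbor, in all colors, and all edges avoiding it are present. -/

/-! ### Degrees and totals of symmetric weights; totals run over ordered pairs, so they are twice
the edge weight. -/

section WeightSums

variable {V : Type*} [DecidableEq V]

/-- The degree of `x` in `S` with respect to the weight `w`. -/
def weightDegree (w : V → V → ℕ) (S : Finset V) (x : V) : ℕ :=
  ∑ y ∈ S, w x y

/-- The sum of the weights of the ordered pairs of elements of `S`. -/
def weightTotal (w : V → V → ℕ) (S : Finset V) : ℕ :=
  ∑ x ∈ S, weightDegree w S x

variable {w : V → V → ℕ} {S : Finset V}

theorem weightDegree_erase (x : V) {y : V} (hy : y ∈ S) :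
    weightDegree w S x = weightDegree w (S.erase y) x + w x y := by
  unfold weightDegree
  rw [← Finset.sum_erase_add _ _ hy]

theorem weightTotal_erase (hcomm : ∀ x y, w x y = w y x) (hself : ∀ x, w x x = 0) {x : V}
    (hx : x ∈ S) :
    weightTotal w S = weightTotal w (S.erase x) + 2 * weightDegree w S x := by
  unfold weightTotal
  rw [← Finset.sum_erase_add _ _ hx]
  have h1 : ∑ y ∈ S.erase x, weightDegree w S y
      = ∑ y ∈ S.erase x, weightDegree w (S.erase x) y + ∑ y ∈ S.erase x, w x y := by
    rw [← Finset.sum_add_distrib]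
    refine Finset.sum_congr rfl fun y _ => ?_
    rw [weightDegree_erase y hx, hcomm y x]
  have h2 : weightDegree w S x = ∑ y ∈ S.erase x, w x y := by
    rw [weightDegree_erase x hx, hself, add_zero]
    rfl
  omega

theorem weightTotal_erase_erase (hcomm : ∀ x y, w x y = w y x) (hself : ∀ x, w x x = 0) {x y : V}
    (hx : x ∈ S) (hy : y ∈ S) (hxy : x ≠ y) :
    weightTotal w S + 2 * w x y = weightTotal w ((S.erase x).erase y)
      + 2 * weightDegree w S x + 2 * weightDegree w S y := by
  have hy' : y ∈ S.erase x := Finset.mem_erase.2 ⟨hxy.symm, hy⟩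
  have h1 := weightTotal_erase hcomm hself hx
  have h2 := weightTotal_erase hcomm hself hy'
  have h3 := weightDegree_erase (w := w) y hx
  rw [hcomm y x] at h3
  omega

theorem even_weightTotal (hcomm : ∀ x y, w x y = w y x) (hself : ∀ x, w x x = 0) (S : Finset V) :
    Even (weightTotal w S) := by
  induction S using Finset.induction_on with
  | empty => simp [weightTotal]
  | insert a S ha ih =>
    rw [weightTotal_erase hcomm hself (Finset.mem_insert_self a S), Finset.erase_insert ha]
    exact ih.add (even_two_mul _)

omit [DecidableEq V] in
theorem weightDegree_mono {S' : Finset V} (h : S' ⊆ S) (x : V) :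
    weightDegree w S' x ≤ weightDegree w S x :=
  Finset.sum_le_sum_of_subset h

end WeightSums

/-! ### Cyclic arrangements of two-ended objects with few conflicts. -/

section Arrangement

/-- A cyclic chain, cut open at `x`, can be extended by one of two new elements if these
conflict with its members fewer times than there are places to insert them. -/
theorem exists_insert_isChain {α : Type*} (R : α → α → Prop) [DecidableRel R] (u : Bool → α) (z : α)
    (l : List α) : ∀ x, List.IsChain R (x :: l ++ [z]) →
    ((x :: l).map fun p => ∑ b, if R p (u b) then 0 else 1).sum
      + ((l ++ [z]).map fun q => ∑ b, if R (u b) q then 0 else 1).sum < 2 * (l.length + 1) →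
    ∃ A B b, l = A ++ B ∧ List.IsChain R (x :: (A ++ u b :: B) ++ [z]) := by
  -- A place with at most one conflict admits one of the two elements. There are `l.length + 1`
  -- places, so two conflicts at each of them would exceed the hypothesis.
  have key : ∀ x y, ((∑ b, if R x (u b) then 0 else 1) + ∑ b, if R (u b) y then 0 else 1) < 2 →
      ∃ b, R x (u b) ∧ R (u b) y := by
    intro x y h
    by_contra! hc
    have h1 := hc true
    have h2 := hc false
    simp only [Fintype.sum_bool] at h
    split_ifs at h <;> simp_all
  induction l with
  | nil =>
    intro x _ h
    obtain ⟨b, h1, h2⟩ := key x z (by simpa using h)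
    exact ⟨[], [], b, rfl, by simp [h1, h2]⟩
  | cons y l ih =>
    intro x hch h
    simp only [List.cons_append, List.isChain_cons_cons] at hch
    by_cases hxy : ((∑ b, if R x (u b) then 0 else 1) + ∑ b, if R (u b) y then 0 else 1) < 2
    · obtain ⟨b, h1, h2⟩ := key x y hxy
      exact ⟨[], y :: l, b, rfl, by simp [h1, h2, hch.2]⟩
    · obtain ⟨A, B, b, rfl, h'⟩ := ih y (by simpa using hch.2) (by
        simp only [List.map_cons, List.sum_cons, List.cons_append, List.length_cons] at h ⊢
        omega)
      exact ⟨y :: A, B, b, rfl, by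
        simp only [List.cons_append, List.isChain_cons_cons] at h' ⊢
        exact ⟨hch.1, h'⟩⟩

variable {ι : Type*} [DecidableEq ι]

/-- The number of conflicts between the ends of `i` and the ends of `j ≠ i`. -/
def conflictWeight (F : ι × Bool → ι × Bool → Prop) [DecidableRel F] (i j : ι) : ℕ :=
  if i = j then 0 else ∑ b, ∑ b', if F (i, b) (j, b') then 1 else 0

variable {F : ι × Bool → ι × Bool → Prop} [DecidableRel F]

theorem conflictWeight_comm (hF : ∀ a b, F a b ↔ F b a) (i j : ι) :
    conflictWeight F i j = conflictWeight F j i := by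
  unfold conflictWeight
  by_cases h : i = j
  · simp [h]
  · rw [if_neg h, if_neg (Ne.symm h), Finset.sum_comm]
    simp only [hF (i, _)]

theorem conflictWeight_self (i : ι) : conflictWeight F i i = 0 := by
  simp [conflictWeight]

/-- Objects with two ends each can be oriented and arranged cyclically such that no two ends in
conflict are linked, if there are at most `2 * k - 3` conflicts, where `k` is the number of
objects. The pair `(i, b)` stands for `i`, entered at its end `b` and left at its end `!b`. -/
theorem exists_cyclic_arrangement (hF : ∀ a b, F a b ↔ F b a) (k : ℕ) : ∀ s : Finset ι,
    s.card = k + 2 → weightTotal (conflictWeight F) s + 6 ≤ 4 * s.card →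
    ∃ x l, ((x :: l).map Prod.fst).Nodup ∧ (∀ i, i ∈ (x :: l).map Prod.fst ↔ i ∈ s) ∧
      List.IsChain (fun a b : ι × Bool => ¬ F (a.1, !a.2) b) (x :: l ++ [x]) := by
  have hc := conflictWeight_comm hF
  have h0 := conflictWeight_self (F := F)
  induction k with
  | zero =>
    intro s hs h
    obtain ⟨i, j, hij, rfl⟩ := Finset.card_eq_two.1 hs
    have ht : conflictWeight F i j ≤ 1 := by
      rw [hs] at h
      simp only [weightTotal, weightDegree, Finset.sum_pair hij, h0, hc j i] at h
      omega
    simp only [conflictWeight, if_neg hij, Fintype.sum_bool] at ht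
    -- The two orientations of `j` use disjoint pairs of links, and a single conflict spoils only
    -- one of them.
    have : ∃ b, ¬ F (i, false) (j, b) ∧ ¬ F (j, !b) (i, true) := by
      by_contra! hcon
      have h1 := hcon true
      have h2 := hcon false
      rw [hF (j, _)] at h1 h2
      simp only [Bool.not_true, Bool.not_false] at h1 h2
      split_ifs at ht <;> first | omega | tauto
    obtain ⟨b, h1, h2⟩ := this
    exact ⟨(i, true), [(j, b)], by simp [hij], by simp, by simp [h1, h2]⟩
  | succ k ih =>
    intro s hs h
    have hne : s.Nonempty := Finset.card_pos.1 (by omega)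
    obtain ⟨i, hi, hmax⟩ := Finset.exists_max_image s (weightDegree (conflictWeight F) s) hne
    have hsum : weightTotal (conflictWeight F) s
        ≤ s.card * weightDegree (conflictWeight F) s i := by
      rw [← smul_eq_mul]
      exact Finset.sum_le_card_nsmul _ _ _ hmax
    have herase := weightTotal_erase hc h0 hi
    have hcard := Finset.card_erase_of_mem hi
    -- Removing an object with at least two conflicts preserves the bound `2 * k - 3`. If all
    -- degrees are at most one, there are at most half as many conflicts as objects, which is few
    -- enough.
    obtain ⟨x, l, hnd, hmem, hch⟩ := ih (s.erase i) (by omega) (by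
      rcases Nat.lt_or_ge 1 (weightDegree (conflictWeight F) s i) with hd | hd
      · omega
      · interval_cases weightDegree (conflictWeight F) s i <;> omega)
    have hdeg : weightDegree (conflictWeight F) s i
        = ((x :: l).map fun p => conflictWeight F i p.1).sum := by
      rw [weightDegree_erase i hi, h0, add_zero]
      have : s.erase i = ((x :: l).map Prod.fst).toFinset := by
        ext j
        rw [List.mem_toFinset, hmem]
      rw [weightDegree, this, List.sum_toFinset _ hnd, List.map_map]
      rfl
    have hlen : l.length + 1 = (s.erase i).card := by
      have : s.erase i = ((x :: l).map Prod.fst).toFinset := by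
        ext j
        rw [List.mem_toFinset, hmem]
      rw [this, List.toFinset_card_of_nodup hnd]
      simp
    have hcount : ((x :: l).map fun p => ∑ b, if ¬ F (p.1, !p.2) (i, b) then 0 else 1).sum
        + ((l ++ [x]).map fun q => ∑ b, if ¬ F (i, !b) q then 0 else 1).sum
        = weightDegree (conflictWeight F) s i := by
      -- After rotation both sums run over the same objects: each contributes its exit as a
      -- predecessor and its entrance as a successor of `i`, so every conflict with `i` is counted
      -- exactly once.
      have hperm : (l ++ [x]).Perm (x :: l) := List.perm_append_singleton x l
      rw [(hperm.map _).sum_eq, ← List.sum_map_add, hdeg]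
      congr 1
      refine List.map_congr_left fun p hp => ?_
      have hpi : i ≠ p.1 := by
        rintro rfl
        exact Finset.notMem_erase _ s ((hmem p.1).1 (List.mem_map_of_mem hp))
      obtain ⟨j, b⟩ := p
      simp only [conflictWeight, if_neg hpi, Fintype.sum_bool, ite_not, hF (j, _)]
      cases b <;> simp <;> ring
    obtain ⟨A, B, b, rfl, h'⟩ := exists_insert_isChain
      (fun a b : ι × Bool => ¬ F (a.1, !a.2) b) (fun b => (i, b)) x l x hch (by
        rw [hcount]; omega)
    have hp : ((x :: (A ++ (i, b) :: B)).map Prod.fst).Perm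
        (i :: (x :: (A ++ B)).map Prod.fst) := by
      have : (x :: (A ++ (i, b) :: B)).Perm ((i, b) :: x :: (A ++ B)) :=
        (List.perm_middle (l₁ := x :: A))
      simpa using this.map Prod.fst
    refine ⟨x, A ++ (i, b) :: B, ?_, ?_, h'⟩
    · rw [hp.nodup_iff, List.nodup_cons, hmem]
      exact ⟨Finset.notMem_erase _ _, hnd⟩
    · intro j
      rw [hp.mem_iff, List.mem_cons, hmem, Finset.mem_erase]
      by_cases hj : j = i
      · simp [hj, hi]
      · simp [hj]

end Arrangement

/-! ### Proper cycles as lists, and missing edges. -/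

namespace EdgeColoredMultigraph

variable {V : Type*} {c : ℕ}

/-- The step relation of a proper cycle, written as a list of vertices paired with the colors of
the edges by which they are left. -/
def Step (G : EdgeColoredMultigraph V c) (p q : V × Fin c) : Prop :=
  (s(p.1, q.1), p.2) ∈ G.edgeSet ∧ p.2 ≠ q.2

theorem hasProperHamiltonianCycle_of_list [Fintype V] (G : EdgeColoredMultigraph V c)
    (hcard : 3 ≤ Fintype.card V) (x : V × Fin c) (l : List (V × Fin c))
    (hnd : ((x :: l).map Prod.fst).Nodup) (hmem : ∀ v, v ∈ (x :: l).map Prod.fst)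
    (hch : List.IsChain G.Step (x :: l ++ [x])) : G.HasProperHamiltonianCycle := by
  classical
  have hlen : (x :: l).length = Fintype.card V := by
    rw [← List.length_map (f := Prod.fst), ← List.toFinset_card_of_nodup hnd, ← Finset.card_univ]
    congr 1
    ext v
    simp only [List.mem_toFinset, hmem, Finset.mem_univ]
  refine ⟨hcard, ?_⟩
  generalize Fintype.card V = n at hlen hcard
  have : NeZero n := ⟨by omega⟩
  have hb : ∀ i : ZMod n, i.val < (x :: l).length := fun i => by rw [hlen]; exact ZMod.val_lt i
  let f : ZMod n → V × Fin c := fun i => (x :: l)[i.val]'(hb i)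
  have hstep : ∀ i, G.Step (f i) (f (i + 1)) := by
    intro i
    have hv : (i + 1).val = (i.val + 1) % n := by
      rw [ZMod.val_add, ZMod.val_one_eq_one_mod, Nat.add_mod_mod]
    have hi := hb i
    have := List.isChain_iff_getElem.1 hch i.val (by
      rw [List.length_append, List.length_singleton]; omega)
    rw [List.getElem_append_left hi] at this
    change G.Step ((x :: l)[i.val]) _
    rcases Nat.lt_or_ge (i.val + 1) n with h | h
    · have h' : (i + 1).val = i.val + 1 := by rw [hv, Nat.mod_eq_of_lt h]
      rw [List.getElem_append_left (by omega)] at this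
      convert this using 2
    · have h1 : i.val + 1 = n := by omega
      have h' : (i + 1).val = 0 := by rw [hv, h1, Nat.mod_self]
      -- The second copy of `x` at the end of the chain provides the step from index `n - 1` back to
      -- `0`.
      rw [List.getElem_append_right (by omega)] at this
      convert this using 1
      simp [f, h']
  have hinj : Function.Injective fun i => (f i).1 := by
    intro i j hij
    have h1 : ((x :: l).map Prod.fst)[i.val]'(by rw [List.length_map]; exact hb i)
        = ((x :: l).map Prod.fst)[j.val]'(by rw [List.length_map]; exact hb j) := by
      rw [List.getElem_map, List.getElem_map]
      exact hij
    exact ZMod.val_injective n ((List.Nodup.getElem_inj_iff hnd).1 h1)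
  refine ⟨fun i => (f i).1, fun i => (f i).2, ⟨hinj, fun v => ?_⟩, fun i => (hstep i).1, ?_⟩
  · obtain ⟨m, hm, rfl⟩ := List.mem_iff_getElem.1 (hmem v)
    rw [List.length_map, hlen] at hm
    refine ⟨(m : ZMod n), ?_⟩
    have : ((m : ZMod n)).val = m := ZMod.val_cast_of_lt hm
    simp only [f, this, List.getElem_map]
  · rintro _ ⟨i, rfl⟩ _ ⟨j, rfl⟩ hne ⟨y, hy1, hy2⟩
    have hij : i ≠ j := fun h => hne (by rw [h])
    simp only [Sym2.mem_iff] at hy1 hy2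
    rcases hy1 with rfl | rfl <;> rcases hy2 with h | h
    · exact absurd (hinj h) hij
    · obtain rfl : i = j + 1 := hinj h
      exact (hstep j).2.symm
    · obtain rfl : i + 1 = j := hinj h
      exact (hstep i).2
    · exact absurd (add_right_cancel (hinj h)) hij

open Classical in
/-- The indicator that `x` and `y` are distinct and not joined by an edge of color `k`. -/
noncomputable def missing (G : EdgeColoredMultigraph V c) (k : Fin c) (x y : V) : ℕ :=
  if x ≠ y ∧ (s(x, y), k) ∉ G.edgeSet then 1 else 0

theorem missing_comm (G : EdgeColoredMultigraph V c) (k : Fin c) (x y : V) :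
    G.missing k x y = G.missing k y x := by
  classical
  exact if_congr (by rw [Sym2.eq_swap, ne_comm]) rfl rfl

theorem missing_self (G : EdgeColoredMultigraph V c) (k : Fin c) (x : V) :
    G.missing k x x = 0 := by
  simp [missing]

theorem missing_le_one (G : EdgeColoredMultigraph V c) (k : Fin c) (x y : V) :
    G.missing k x y ≤ 1 := by
  unfold missing
  split_ifs <;> omega

theorem mem_edgeSet_of_missing_eq_zero {G : EdgeColoredMultigraph V c} {k : Fin c} {x y : V}
    (hxy : x ≠ y) (h : G.missing k x y = 0) : (s(x, y), k) ∈ G.edgeSet := by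
  by_contra hn
  simp [missing, hxy, hn] at h

/-- The number of colors among `j` and `l` that are missing between `x` and `y`. -/
noncomputable def missingPair (G : EdgeColoredMultigraph V c) (j l : Fin c) (x y : V) : ℕ :=
  G.missing j x y + G.missing l x y

end EdgeColoredMultigraph

/-! ### Segments, tilings, and linking segments to a cycle. -/

/-- A list of two or three vertices along which there is little missing weight. -/
def IsSegment {V : Type*} (w : V → V → ℕ) (u : List V) : Prop :=
  (∃ a b, u = [a, b] ∧ w a b ≤ 1) ∨ ∃ a v b, u = [a, v, b] ∧ w v a + w v b ≤ 1

namespace EdgeColoredMultigraph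

variable {V : Type*} {c : ℕ}

/-- The vertex list `u`, or its reverse, when `b` is `false`. -/
def orient (u : List V) (b : Bool) : List V := if b then u else u.reverse

/-- A segment can be properly colored, in both directions, with a given color reserved for the
edge by which it is left. -/
theorem exists_coloring_of_isSegment (G : EdgeColoredMultigraph V c) {i j l : Fin c}
    (hij : i ≠ j) (hil : i ≠ l) (hjl : j ≠ l) {u : List V} (hnd : u.Nodup)
    (hu : IsSegment (G.missingPair j l) u) :
    ∃ P : Bool → List (V × Fin c), ∀ b, (P b).map Prod.fst = orient u b ∧
      List.IsChain G.Step (P b) ∧ (∀ p ∈ (P b).head?, p.2 ≠ i) ∧ ∀ p ∈ (P b).getLast?, p.2 = i := by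
  rcases hu with ⟨a, b, rfl, h⟩ | ⟨a, v, b, rfl, h⟩
  · have hab : a ≠ b := by simpa using hnd
    obtain ⟨k, hk, hmem⟩ : ∃ k, k ≠ i ∧ (s(a, b), k) ∈ G.edgeSet := by
      unfold missingPair at h
      rcases Nat.eq_zero_or_pos (G.missing j a b) with h0 | h0
      · exact ⟨j, hij.symm, mem_edgeSet_of_missing_eq_zero hab h0⟩
      · exact ⟨l, hil.symm, mem_edgeSet_of_missing_eq_zero hab (by omega)⟩
    have hmem' : (s(b, a), k) ∈ G.edgeSet := by rwa [Sym2.eq_swap]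
    refine ⟨fun d => if d then [(a, k), (b, i)] else [(b, k), (a, i)], fun d => ?_⟩
    cases d <;> simp [orient, Step, hk, hmem, hmem']
  · have hva : v ≠ a := by
      rintro rfl
      simp at hnd
    have hvb : v ≠ b := by
      rintro rfl
      simp at hnd
    -- The two ways to give `j` and `l` to the edges at `v` use disjoint sets of colored edges. At
    -- most one of these four is missing, so one way is intact.
    obtain ⟨p, q, hp, hq, hpq, h1, h2⟩ : ∃ p q, p ≠ i ∧ q ≠ i ∧ p ≠ q ∧
        (s(v, a), p) ∈ G.edgeSet ∧ (s(v, b), q) ∈ G.edgeSet := by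
      unfold missingPair at h
      rcases Nat.eq_zero_or_pos (G.missing j v a + G.missing l v b) with h0 | h0
      · exact ⟨j, l, hij.symm, hil.symm, hjl, mem_edgeSet_of_missing_eq_zero hva (by omega),
          mem_edgeSet_of_missing_eq_zero hvb (by omega)⟩
      · exact ⟨l, j, hil.symm, hij.symm, hjl.symm, mem_edgeSet_of_missing_eq_zero hva (by omega),
          mem_edgeSet_of_missing_eq_zero hvb (by omega)⟩
    have h1' : (s(a, v), p) ∈ G.edgeSet := by rwa [Sym2.eq_swap]
    have h2' : (s(b, v), q) ∈ G.edgeSet := by rwa [Sym2.eq_swap]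
    refine ⟨fun d => if d then [(a, p), (v, q), (b, i)] else [(b, q), (v, p), (a, i)],
      fun d => ?_⟩
    cases d <;> simp [orient, Step, hp, hq, hpq, hpq.symm, h1, h2, h1', h2']

end EdgeColoredMultigraph

/-- A partition of `S` into segments, at most one of which has three vertices. -/
structure IsTiling {V : Type*} (w : V → V → ℕ) (S : Finset V) (M : List (List V)) : Prop where
  isSegment : ∀ u ∈ M, IsSegment w u
  nodup : M.flatten.Nodup
  mem_iff : ∀ x, x ∈ M.flatten ↔ x ∈ S
  -- As segments have two or three vertices, this forces exactly one triple if `S.card` is odd and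
  -- none if it is even.
  length : M.length = S.card / 2

namespace EdgeColoredMultigraph

variable {V : Type*} {c : ℕ}

/-- The pair `{x, y}` cannot be used to link two segments of `M`. -/
def IsHidden (M : List (List V)) (x y : V) : Prop :=
  (∃ u ∈ M, x ∈ u ∧ y ∈ u) ∨ (∃ a b, [a, x, b] ∈ M) ∨ ∃ a b, [a, y, b] ∈ M

theorem _root_.IsSegment.ne_nil {w : V → V → ℕ} {u : List V} (hu : IsSegment w u) : u ≠ [] := by
  rcases hu with ⟨a, b, rfl, _⟩ | ⟨a, v, b, rfl, _⟩ <;> simp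

theorem orient_ne_nil {u : List V} (hu : u ≠ []) (b : Bool) : orient u b ≠ [] := by
  cases b <;> simpa [orient] using hu

theorem mem_orient {u : List V} {b : Bool} {x : V} : x ∈ orient u b ↔ x ∈ u := by
  cases b <;> simp [orient]

theorem orient_perm (u : List V) (b : Bool) : (orient u b).Perm u := by
  cases b
  · exact u.reverse_perm
  · exact List.Perm.refl u

theorem getLast?_orient (u : List V) (b : Bool) : (orient u b).getLast? = (orient u !b).head? := by
  cases b <;> simp [orient]

theorem index_eq_of_mem {M : List (List V)} (hM : M.flatten.Nodup) {i j : Fin M.length} {x : V}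
    (hi : x ∈ M[i]) (hj : x ∈ M[j]) : i = j := by
  have hp := (List.nodup_flatten.1 hM).2
  rw [List.pairwise_iff_getElem] at hp
  rcases lt_trichotomy i j with h | h | h
  · exact absurd hj (hp i j i.2 j.2 h hi)
  · exact h
  · exact absurd hi (hp j i j.2 i.2 h hj)

section Ends

variable {w : V → V → ℕ} {S : Finset V} {M : List (List V)}
  {e : Fin M.length × Bool → V}

theorem end_mem (he : ∀ a, e a ∈ (orient M[a.1] a.2).head?) (a : Fin M.length × Bool) :
    e a ∈ M[a.1] :=
  mem_orient.1 (List.mem_of_mem_head? (he a))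

theorem end_injective (hM : IsTiling w S M) (he : ∀ a, e a ∈ (orient M[a.1] a.2).head?) :
    Function.Injective e := by
  rintro ⟨i, b⟩ ⟨j, b'⟩ h
  have h1 := end_mem he (i, b)
  have h2 := end_mem he (j, b')
  rw [← h] at h2
  obtain rfl := index_eq_of_mem hM.nodup h1 h2
  by_contra hne
  have hb : b ≠ b' := fun hb => hne (by rw [hb])
  have hnd : M[i].Nodup := (List.nodup_flatten.1 hM.nodup).1 _ (List.getElem_mem i.2)
  have e1 := he (i, b)
  have e2 := he (i, b')
  rw [← h] at e2
  simp only at e1 e2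
  rcases hM.isSegment _ (List.getElem_mem i.2) with ⟨x, y, hu, -⟩ | ⟨x, y, z, hu, -⟩ <;>
    simp only [Fin.getElem_fin] at e1 e2 hnd <;> rw [hu] at e1 e2 hnd <;>
    cases b <;> cases b' <;> simp_all [orient]

/-- Links join only ends of segments; this is why a missing edge at the middle of a triple does no
harm. -/
theorem end_ne_middle (hM : IsTiling w S M) (he : ∀ a, e a ∈ (orient M[a.1] a.2).head?)
    {x v y : V} (h : [x, v, y] ∈ M) (a : Fin M.length × Bool) : e a ≠ v := by
  rintro rfl
  obtain ⟨i, hi, hu⟩ := List.mem_iff_getElem.1 h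
  have h1 : e a ∈ M[(⟨i, hi⟩ : Fin M.length)] := by
    rw [Fin.getElem_fin, hu]
    simp
  have h2 := index_eq_of_mem hM.nodup h1 (end_mem he a)
  have hnd : M[i].Nodup := (List.nodup_flatten.1 hM.nodup).1 _ (List.getElem_mem hi)
  have h3 := he a
  rw [hu] at hnd
  rcases a with ⟨j, b⟩
  obtain rfl : ⟨i, hi⟩ = j := h2
  simp only [Fin.getElem_fin] at h3
  rw [hu] at h3
  cases b <;> simp_all [orient]

/-- The conflicts between ends of segments are bounded by any weight that counts them. -/
theorem weightTotal_conflictWeight_le [Fintype V] (hM : IsTiling w S M)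
    (he : ∀ a, e a ∈ (orient M[a.1] a.2).head?)
    (F : Fin M.length × Bool → Fin M.length × Bool → Prop) [DecidableRel F] (f : V → V → ℕ)
    (hf : ∀ a b, a.1 ≠ b.1 → F a b → 1 ≤ f (e a) (e b)) :
    weightTotal (conflictWeight F) Finset.univ ≤ weightTotal f Finset.univ := by
  classical
  have hinj := end_injective hM he
  calc weightTotal (conflictWeight F) Finset.univ
      ≤ ∑ i : Fin M.length, ∑ j : Fin M.length, ∑ b, ∑ b', f (e (i, b)) (e (j, b')) := by
        refine Finset.sum_le_sum fun i _ => Finset.sum_le_sum fun j _ => ?_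
        unfold conflictWeight
        split_ifs with hij
        · exact Nat.zero_le _
        · refine Finset.sum_le_sum fun b _ => Finset.sum_le_sum fun b' _ => ?_
          split_ifs with hF
          · exact hf _ _ hij hF
          · exact Nat.zero_le _
    _ = ∑ a, ∑ b, f (e a) (e b) := by
        simp only [Fintype.sum_prod_type]
        refine Finset.sum_congr rfl fun i _ => ?_
        rw [Finset.sum_comm]
    -- As `e` is injective, no pair of vertices is counted twice.
    _ = ∑ x ∈ Finset.univ.image e, ∑ y ∈ Finset.univ.image e, f x y := by
        rw [Finset.sum_image hinj.injOn]
        refine Finset.sum_congr rfl fun a _ => ?_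
        rw [Finset.sum_image hinj.injOn]
    _ ≤ ∑ x ∈ Finset.univ.image e, ∑ y, f x y :=
        Finset.sum_le_sum fun x _ => Finset.sum_le_sum_of_subset (Finset.subset_univ _)
    _ ≤ weightTotal f Finset.univ := Finset.sum_le_sum_of_subset (Finset.subset_univ _)

end Ends

open Classical in
/-- If few edges of color `i` between ends of different segments are missing, the segments can be
linked to a proper Hamiltonian cycle. -/
theorem hasProperHamiltonianCycle_of_conflictWeight [Fintype V]
    (G : EdgeColoredMultigraph V c)
    {i j l : Fin c} (hij : i ≠ j) (hil : i ≠ l) (hjl : j ≠ l) (hcard : 4 ≤ Fintype.card V)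
    {M : List (List V)} (hM : IsTiling (G.missingPair j l) Finset.univ M)
    {e : Fin M.length × Bool → V} (he : ∀ a, e a ∈ (orient M[a.1] a.2).head?)
    (h : weightTotal (conflictWeight fun a b => (s(e a, e b), i) ∉ G.edgeSet)
      (Finset.univ : Finset (Fin M.length)) + 6 ≤ 4 * M.length) :
    G.HasProperHamiltonianCycle := by
  have hlen := hM.length
  rw [Finset.card_univ] at hlen
  have hcol : ∀ a : Fin M.length, ∃ P : Bool → List (V × Fin c), ∀ b,
      (P b).map Prod.fst = orient M[a] b ∧ List.IsChain G.Step (P b) ∧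
      (∀ p ∈ (P b).head?, p.2 ≠ i) ∧ ∀ p ∈ (P b).getLast?, p.2 = i := fun a =>
    G.exists_coloring_of_isSegment hij hil hjl
      ((List.nodup_flatten.1 hM.nodup).1 _ (List.getElem_mem a.2))
      (hM.isSegment _ (List.getElem_mem a.2))
  choose P hPmap hPch hPhead hPlast using hcol
  obtain ⟨x, m, hnd, hmem, hch⟩ := exists_cyclic_arrangement
    (F := fun a b => (s(e a, e b), i) ∉ G.edgeSet)
    (fun a b => by rw [Sym2.eq_swap]) (M.length - 2) Finset.univ
    (by rw [Finset.card_univ, Fintype.card_fin]; omega)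
    (by rw [Finset.card_univ, Fintype.card_fin]; exact h)
  let Q : Fin M.length × Bool → List (V × Fin c) := fun a => P a.1 a.2
  have hQne : ∀ a, Q a ≠ [] := fun a ha => by
    have h1 := hPmap a.1 a.2
    have h2 : P a.1 a.2 = [] := ha
    rw [h2] at h1
    exact orient_ne_nil (IsSegment.ne_nil (hM.isSegment _ (List.getElem_mem a.1.2))) _ h1.symm
  have hQhead : ∀ a, ∀ p ∈ (Q a).head?, p.1 = e a := fun a p hp => by
    have h1 := he a
    rw [← hPmap a.1 a.2, List.head?_map] at h1
    rw [show (P a.1 a.2).head? = some p from hp] at h1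
    simpa using h1
  have hQlast : ∀ a, ∀ p ∈ (Q a).getLast?, p.1 = e (a.1, !a.2) := fun a p hp => by
    have h1 := he (a.1, !a.2)
    rw [← getLast?_orient, ← hPmap a.1 a.2, List.getLast?_map] at h1
    rw [show (P a.1 a.2).getLast? = some p from hp] at h1
    simpa using h1
  -- Each segment is left in color `i` and continues in a color other than `i`, so the colors also
  -- differ at the junctions.
  have hflat : List.IsChain G.Step ((x :: m ++ [x]).map Q).flatten := by
    rw [List.isChain_flatten (by
      intro hn
      obtain ⟨a, -, ha⟩ := List.mem_map.1 hn
      exact hQne a ha)]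
    refine ⟨fun q hq => ?_, ?_⟩
    · obtain ⟨a, -, rfl⟩ := List.mem_map.1 hq
      exact hPch a.1 a.2
    · rw [List.isChain_map]
      refine hch.imp fun a b hab p hp q hq => ⟨?_, ?_⟩
      · rw [hQlast a p hp, hQhead b q hq, hPlast a.1 a.2 p hp]
        exact not_not.1 hab
      · rw [hPlast a.1 a.2 p hp]
        exact (hPhead b.1 b.2 q hq).symm
  obtain ⟨y, t, hyt⟩ := List.exists_cons_of_ne_nil (hQne x)
  have hperm : ((y :: (t ++ (m.map Q).flatten)).map Prod.fst).Perm M.flatten := by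
    have h1 : (y :: (t ++ (m.map Q).flatten)).map Prod.fst
        = (x :: m).flatMap fun a => orient M[a.1] a.2 := by
      have : y :: (t ++ (m.map Q).flatten) = (x :: m).flatMap Q := by
        rw [List.flatMap_cons, hyt]
        rfl
      rw [this, List.map_flatMap]
      exact List.flatMap_congr fun a _ => hPmap a.1 a.2
    have h2 : ((x :: m).flatMap fun a => orient M[a.1] a.2).Perm
        ((x :: m).flatMap fun a => M[a.1]) :=
      List.Perm.flatMap_left _ fun a _ => orient_perm _ _
    have h3 : ((x :: m).flatMap fun a => M[a.1])
        = ((x :: m).map Prod.fst).flatMap fun a => M[a] := by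
      rw [List.flatMap_map]
    have h4 : ((x :: m).map Prod.fst).Perm (List.finRange M.length) := by
      rw [List.perm_ext_iff_of_nodup hnd (List.nodup_finRange _)]
      intro a
      rw [hmem]
      simp
    have h5 : (List.finRange M.length).flatMap (fun a => M[a]) = M.flatten := by
      conv_rhs => rw [← List.map_getElem_finRange M]
      rfl
    rw [h1]
    refine h2.trans ?_
    rw [h3, ← h5]
    exact h4.flatMap_right _
  refine G.hasProperHamiltonianCycle_of_list (by omega) y (t ++ (m.map Q).flatten)
    (hperm.nodup_iff.2 hM.nodup)
    (fun v => hperm.mem_iff.2 ((hM.mem_iff v).2 (Finset.mem_univ v))) (hflat.prefix ?_)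
  -- The flattened chain traverses the first segment a second time; only its first vertex `y` is
  -- needed to close the cycle.
  refine ⟨t, ?_⟩
  simp [hyt]

theorem exists_ends {w : V → V → ℕ} {S : Finset V} {M : List (List V)} (hM : IsTiling w S M) :
    ∃ e : Fin M.length × Bool → V, ∀ a, e a ∈ (orient M[a.1] a.2).head? :=
  ⟨fun a => (orient M[a.1] a.2).head
      (orient_ne_nil (IsSegment.ne_nil (hM.isSegment _ (List.getElem_mem a.1.2))) _),
    fun _ => List.head?_eq_some_head _⟩

/-- A tiling in the colors `j` and `l` yields a proper Hamiltonian cycle if few edges of color `i`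
are missing. -/
theorem hasProperHamiltonianCycle_of_isTiling [Fintype V] (G : EdgeColoredMultigraph V c)
    {i j l : Fin c} (hij : i ≠ j) (hil : i ≠ l) (hjl : j ≠ l) (hcard : 4 ≤ Fintype.card V)
    {M : List (List V)} (hM : IsTiling (G.missingPair j l) Finset.univ M)
    (h : weightTotal (G.missing i) Finset.univ + 6 ≤ 4 * M.length) :
    G.HasProperHamiltonianCycle := by
  classical
  obtain ⟨e, he⟩ := exists_ends hM
  refine G.hasProperHamiltonianCycle_of_conflictWeight hij hil hjl hcard hM he
    (le_trans (Nat.add_le_add_right (weightTotal_conflictWeight_le hM he _ (G.missing i) ?_) 6) h)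
  intro a b hab hF
  have hne : e a ≠ e b := fun h => hab (congrArg Prod.fst (end_injective hM he h))
  simp [missing, hne, hF]

/-- If a missing edge of color `i` is hidden by the tiling, one more such edge may be missing. -/
theorem hasProperHamiltonianCycle_of_isHidden [Fintype V] (G : EdgeColoredMultigraph V c)
    {i j l : Fin c} (hij : i ≠ j) (hil : i ≠ l) (hjl : j ≠ l) (hcard : 4 ≤ Fintype.card V)
    {M : List (List V)} (hM : IsTiling (G.missingPair j l) Finset.univ M) {x y : V}
    (hxy : G.missing i x y = 1) (hhid : IsHidden M x y)
    (h : weightTotal (G.missing i) Finset.univ + 4 ≤ 4 * M.length) :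
    G.HasProperHamiltonianCycle := by
  classical
  have hne : x ≠ y := by
    rintro rfl
    simp [missing_self] at hxy
  obtain ⟨e, he⟩ := exists_ends hM
  -- Forgetting the hidden edge lowers the total by two, one for each order of its ends.
  let f : V → V → ℕ := fun u v => if s(u, v) = s(x, y) then 0 else G.missing i u v
  have hf : weightTotal f Finset.univ + 2 ≤ weightTotal (G.missing i) Finset.univ := by
    have h1 : weightTotal (G.missing i) Finset.univ = weightTotal f Finset.univ
        + ∑ u, ∑ v, if s(u, v) = s(x, y) then 1 else 0 := by
      unfold weightTotal weightDegree
      rw [← Finset.sum_add_distrib]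
      refine Finset.sum_congr rfl fun u _ => ?_
      rw [← Finset.sum_add_distrib]
      refine Finset.sum_congr rfl fun v _ => ?_
      simp only [f]
      split_ifs with huv
      · rcases Sym2.eq_iff.1 huv with ⟨rfl, rfl⟩ | ⟨rfl, rfl⟩
        · rw [hxy]
        · rw [missing_comm, hxy]
      · rfl
    have h2 : 2 ≤ ∑ u, ∑ v, if s(u, v) = s(x, y) then 1 else 0 := by
      rw [← Fintype.sum_prod_type' (f := fun u v => if s(u, v) = s(x, y) then 1 else 0),
        ← Finset.card_filter]
      have hsub : ({(x, y), (y, x)} : Finset (V × V))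
          ⊆ Finset.univ.filter fun p => s(p.1, p.2) = s(x, y) := by
        intro p hp
        simp only [Finset.mem_insert, Finset.mem_singleton] at hp
        rcases hp with rfl | rfl <;> simp
      have hc2 : ({(x, y), (y, x)} : Finset (V × V)).card = 2 :=
        Finset.card_pair fun hp => hne (congrArg Prod.fst hp)
      exact hc2 ▸ Finset.card_le_card hsub
    omega
  have hcon : ∀ a b, a.1 ≠ b.1 → s(e a, e b) ≠ s(x, y) := by
    have key : ∀ a b, a.1 ≠ b.1 → e a = x → e b ≠ y := by
      rintro a b hab hx hy
      rcases hhid with ⟨u, hu, hxu, hyu⟩ | ⟨p, q, hu⟩ | ⟨p, q, hu⟩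
      · obtain ⟨k, hk, rfl⟩ := List.mem_iff_getElem.1 hu
        have h1 := index_eq_of_mem hM.nodup (i := a.1) (j := ⟨k, hk⟩) (hx ▸ end_mem he a) hxu
        have h2 := index_eq_of_mem hM.nodup (i := b.1) (j := ⟨k, hk⟩) (hy ▸ end_mem he b) hyu
        exact hab (h1.trans h2.symm)
      · exact end_ne_middle hM he hu a hx
      · exact end_ne_middle hM he hu b hy
    intro a b hab hs
    rcases Sym2.eq_iff.1 hs with ⟨h1, h2⟩ | ⟨h1, h2⟩
    · exact key a b hab h1 h2
    · exact key b a hab.symm h2 h1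
  have hle := weightTotal_conflictWeight_le hM he (fun a b => (s(e a, e b), i) ∉ G.edgeSet) f
    (fun a b hab hF => by
      have hne' : e a ≠ e b := fun h => hab (congrArg Prod.fst (end_injective hM he h))
      simp only [f, if_neg (hcon a b hab)]
      simp [missing, hne', hF])
  exact G.hasProperHamiltonianCycle_of_conflictWeight hij hil hjl hcard hM he (by omega)

end EdgeColoredMultigraph

/-! ### Extending tilings. -/

section Tiling

variable {V : Type*} [DecidableEq V] {w : V → V → ℕ} {S : Finset V} {M : List (List V)}

omit [DecidableEq V] in
theorem isTiling_empty : IsTiling w (∅ : Finset V) [] :=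
  ⟨by simp, by simp, by simp, by simp⟩

/-- A tiling is extended by a pair. -/
theorem IsTiling.cons_pair {x y : V} (hx : x ∈ S) (hy : y ∈ S) (hxy : x ≠ y) (h : w x y ≤ 1)
    (hM : IsTiling w ((S.erase x).erase y) M) : IsTiling w S ([x, y] :: M) := by
  have hy' : y ∈ S.erase x := Finset.mem_erase.2 ⟨hxy.symm, hy⟩
  have h1 := Finset.card_erase_of_mem hx
  have h2 := Finset.card_erase_of_mem hy'
  have h3 := Finset.card_pos.2 ⟨y, hy'⟩
  refine ⟨?_, ?_, ?_, ?_⟩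
  · intro u hu
    rcases List.mem_cons.1 hu with rfl | hu
    · exact Or.inl ⟨x, y, rfl, h⟩
    · exact hM.isSegment u hu
  · simp only [List.flatten_cons, List.cons_append, List.nil_append, List.nodup_cons,
      List.mem_cons, hM.mem_iff, hM.nodup]
    simp [hxy]
  · intro z
    simp only [List.flatten_cons, List.cons_append, List.nil_append,
      List.mem_cons, hM.mem_iff, Finset.mem_erase]
    by_cases hzx : z = x
    · simp [hzx, hx]
    · by_cases hzy : z = y <;> simp [hzx, hzy, hy]
  · rw [List.length_cons, hM.length]
    omega

/-- A tiling of a set of even cardinality is extended by a triple. -/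
theorem IsTiling.cons_triple {a v b : V} (ha : a ∈ S) (hv : v ∈ S) (hb : b ∈ S) (hva : v ≠ a)
    (hvb : v ≠ b) (hab : a ≠ b) (hS : Odd S.card) (h : w v a + w v b ≤ 1)
    (hM : IsTiling w (((S.erase v).erase a).erase b) M) : IsTiling w S ([a, v, b] :: M) := by
  have ha' : a ∈ S.erase v := Finset.mem_erase.2 ⟨hva.symm, ha⟩
  have hb' : b ∈ (S.erase v).erase a :=
    Finset.mem_erase.2 ⟨hab.symm, Finset.mem_erase.2 ⟨hvb.symm, hb⟩⟩
  have h1 := Finset.card_erase_of_mem hv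
  have h2 := Finset.card_erase_of_mem ha'
  have h3 := Finset.card_erase_of_mem hb'
  have h4 := Finset.card_pos.2 ⟨b, hb'⟩
  refine ⟨?_, ?_, ?_, ?_⟩
  · intro u hu
    rcases List.mem_cons.1 hu with rfl | hu
    · exact Or.inr ⟨a, v, b, rfl, h⟩
    · exact hM.isSegment u hu
  · simp only [List.flatten_cons, List.cons_append, List.nil_append, List.nodup_cons,
      List.mem_cons, hM.mem_iff, hM.nodup]
    simp [hva.symm, hvb, hab]
  · intro z
    simp only [List.flatten_cons, List.cons_append, List.nil_append,
      List.mem_cons, hM.mem_iff, Finset.mem_erase]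
    by_cases hzv : z = v
    · simp [hzv, hv]
    · by_cases hza : z = a
      · simp [hza, ha]
      · by_cases hzb : z = b <;> simp [hzv, hza, hzb, hb]
  · rw [List.length_cons, hM.length]
    obtain ⟨m, hm⟩ := hS
    omega

/-- All segments of a tiling of a set of even cardinality are pairs. -/
theorem IsTiling.exists_eq_pair (hM : IsTiling w S M) (hS : Even S.card) {u : List V}
    (hu : u ∈ M) : ∃ a b, u = [a, b] ∧ w a b ≤ 1 := by
  refine (hM.isSegment u hu).resolve_right ?_
  rintro ⟨a, v, b, rfl, -⟩
  have hcard : M.flatten.length = S.card := by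
    rw [← List.toFinset_card_of_nodup hM.nodup]
    congr 1
    ext x
    rw [List.mem_toFinset, hM.mem_iff]
  obtain ⟨A, B, rfl⟩ := List.append_of_mem hu
  -- Every segment has at least two vertices, so `S.card / 2` segments including a triple would
  -- cover more than `S.card` vertices.
  have hlen : ∀ L : List (List V), (∀ u ∈ L, IsSegment w u) → 2 * L.length ≤ L.flatten.length := by
    intro L
    induction L with
    | nil => simp
    | cons u L ih =>
      intro hL
      have h1 := ih fun u hu => hL u (List.mem_cons_of_mem _ hu)
      have h2 : 2 ≤ u.length := by
        rcases hL u List.mem_cons_self with ⟨a, b, rfl, -⟩ | ⟨a, v, b, rfl, -⟩ <;> simp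
      simp only [List.flatten_cons, List.length_append, List.length_cons]
      omega
  have h1 := hlen A fun u hu => hM.isSegment u (by simp [hu])
  have h2 := hlen B fun u hu => hM.isSegment u (by simp [hu])
  have h3 := hM.length
  simp only [List.flatten_append, List.flatten_cons, List.length_append, List.length_cons,
    List.length_nil] at hcard h3
  obtain ⟨m, hm⟩ := hS
  omega

theorem IsTiling.sum_map_weight (hM : IsTiling w S M) (f : V → ℕ) :
    (M.map fun u => (u.map f).sum).sum = ∑ x ∈ S, f x := by
  have : S = M.flatten.toFinset := by
    ext x
    rw [List.mem_toFinset, hM.mem_iff]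
  rw [this, List.sum_toFinset f hM.nodup, List.map_flatten, List.sum_flatten, List.map_map]
  rfl

/-- A vertex of small degree can be inserted in the middle of some pair. -/
theorem IsTiling.exists_insert {v : V} (hv : v ∈ S) (hM : IsTiling w (S.erase v) M)
    (hS : Odd S.card) (hdeg : weightDegree w (S.erase v) v + 2 ≤ S.card) :
    ∃ a b M', IsTiling w S ([a, v, b] :: M') := by
  have hc := Finset.card_erase_of_mem hv
  obtain ⟨m, hm⟩ := hS
  have heven : Even (S.erase v).card := ⟨m, by omega⟩
  -- Otherwise each of the `(S.card - 1) / 2` pairs receives weight at least two from `v`, against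
  -- the degree bound.
  obtain ⟨u, hu, hlt⟩ : ∃ u ∈ M, (u.map (w v)).sum ≤ 1 := by
    by_contra! hcon
    have h1 : (M.map fun _ => 2).sum ≤ (M.map fun u => (u.map (w v)).sum).sum :=
      List.sum_le_sum fun u hu => hcon u hu
    have h2 := hM.sum_map_weight (w v)
    have h3 := hM.length
    rw [h2] at h1
    rw [List.map_const', List.sum_replicate, smul_eq_mul] at h1
    unfold weightDegree at hdeg
    omega
  obtain ⟨a, b, rfl, hab⟩ := hM.exists_eq_pair heven hu
  obtain ⟨A, B, rfl⟩ := List.append_of_mem hu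
  have hp : (A ++ [a, b] :: B).Perm ([a, b] :: (A ++ B)) := List.perm_middle
  have hnd := hM.nodup
  rw [hp.flatten.nodup_iff] at hnd
  simp only [List.flatten_cons, List.cons_append, List.nil_append, List.nodup_cons,
      List.mem_cons, not_or] at hnd
  obtain ⟨⟨hne, ha⟩, hb, hnd⟩ := hnd
  have hmem : ∀ x, x ∈ S.erase v ↔ x = a ∨ x = b ∨ x ∈ (A ++ B).flatten := by
    intro x
    rw [← hM.mem_iff, hp.flatten.mem_iff]
    simp
  have haS := (hmem a).2 (Or.inl rfl)
  have hbS := (hmem b).2 (Or.inr (Or.inl rfl))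
  refine ⟨a, b, A ++ B, IsTiling.cons_triple (Finset.mem_of_mem_erase haS) hv
    (Finset.mem_of_mem_erase hbS) (Finset.ne_of_mem_erase haS).symm
    (Finset.ne_of_mem_erase hbS).symm hne ⟨m, hm⟩ (by simpa using hlt)
    ⟨fun u hu => hM.isSegment u (hp.mem_iff.2 (List.mem_cons_of_mem _ hu)), hnd, ?_, ?_⟩⟩
  · intro x
    rw [Finset.mem_erase, Finset.mem_erase, hmem]
    constructor
    · intro hx
      exact ⟨fun h => hb (h ▸ hx), fun h => ha (h ▸ hx), Or.inr (Or.inr hx)⟩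
    · rintro ⟨h1, h2, h3⟩
      simpa [h1, h2] using h3
  · have h1 := hM.length
    rw [hp.length_eq, List.length_cons] at h1
    rw [Finset.card_erase_of_mem (Finset.mem_erase.2 ⟨Ne.symm hne, hbS⟩),
      Finset.card_erase_of_mem haS]
    omega

end Tiling

/-! ### Existence of tilings for weight at most `3 * n - 7`. -/

section TilingExistence

variable {V : Type*} [DecidableEq V] {w : V → V → ℕ} {S : Finset V}

/-- In a set with little weight some vertex forms, with a given vertex `x` of maximum degree, a
pair of weight at most one whose removal decreases the weight sufficiently. -/
theorem exists_partner (hcomm : ∀ x y, w x y = w y x) (hself : ∀ x, w x x = 0)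
    (hle : ∀ x y, w x y ≤ 2) (hS : 5 ≤ S.card) (hT : weightTotal w S + 14 ≤ 6 * S.card) {x : V}
    (hx : x ∈ S) (hmax : ∀ y ∈ S, weightDegree w S y ≤ weightDegree w S x)
    (hiso : ∃ y ∈ S, y ≠ x ∧ w x y ≤ 1) :
    ∃ y ∈ S, y ≠ x ∧ w x y ≤ 1 ∧ weightTotal w ((S.erase x).erase y) + 26 ≤ 6 * S.card := by
  by_contra! hcon
  obtain ⟨T, hT2⟩ := even_weightTotal hcomm hself S
  set n := S.card with hn
  set D := weightDegree w S x with hD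
  set S' := S.erase x with hS'
  have hS'card : S'.card + 1 = n := by
    rw [hS', Finset.card_erase_add_one hx]
  have htot : weightTotal w S = weightTotal w S' + 2 * D := weightTotal_erase hcomm hself hx
  have hDS' : D = ∑ y ∈ S', w x y := by
    rw [hD, weightDegree_erase x hx, hself, add_zero]
    rfl
  have h2TD : weightTotal w S ≤ n * D := by
    rw [← smul_eq_mul]
    exact Finset.sum_le_card_nsmul _ _ _ hmax
  -- With `T` the edge weight, a failing partner leaves weight at least `3 * n - 12`, one more than
  -- `3 * (n - 2) - 7`. So its degree in `S'` is at most `r = T + 12 - D - 3 * n`.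
  have hr : ∀ y ∈ S', w x y ≤ 1 → weightDegree w S' y + D + 3 * n ≤ T + 12 := by
    intro y hy hw
    have hyx := Finset.ne_of_mem_erase hy
    have hyS := Finset.mem_of_mem_erase hy
    have h1 := hcon y hyS hyx hw
    have h2 := weightTotal_erase hcomm hself hy
    obtain ⟨t, ht⟩ := even_weightTotal hcomm hself (S'.erase y)
    omega
  have he : ∀ y ∈ S', weightDegree w S' y + w x y ≤ D := by
    intro y hy
    have h1 := hmax y (Finset.mem_of_mem_erase hy)
    rw [weightDegree_erase y hx, hcomm y x] at h1
    exact h1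
  have hsplit : weightTotal w S' = ∑ y ∈ S'.filter (fun y => w x y ≤ 1), weightDegree w S' y
      + ∑ y ∈ S'.filter (fun y => ¬ w x y ≤ 1), weightDegree w S' y :=
    (Finset.sum_filter_add_sum_filter_not _ _ _).symm
  set Q := S'.filter (fun y => ¬ w x y ≤ 1) with hQ
  set N := S'.filter (fun y => w x y ≤ 1) with hN
  have hNQ : N.card + Q.card = S'.card := Finset.card_filter_add_card_filter_not _
  have hqD : Q.card * 2 ≤ D := by
    rw [hDS', ← smul_eq_mul]
    refine le_trans (Finset.card_nsmul_le_sum Q (w x) 2 fun y hy => ?_)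
      (Finset.sum_le_sum_of_subset (Finset.filter_subset _ _))
    have := (Finset.mem_filter.1 hy).2
    omega
  obtain ⟨y₀, hy₀S, hy₀x, hy₀w⟩ := hiso
  have hr₀ := hr y₀ (Finset.mem_erase.2 ⟨hy₀x, hy₀S⟩) hy₀w
  obtain ⟨r, hr'⟩ : ∃ r, T + 12 = r + D + 3 * n := ⟨T + 12 - D - 3 * n, by omega⟩
  have hNsum : ∑ y ∈ N, weightDegree w S' y ≤ N.card * r := by
    rw [← smul_eq_mul]
    refine Finset.sum_le_card_nsmul _ _ _ fun y hy => ?_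
    have := hr y (Finset.mem_filter.1 hy).1 (Finset.mem_filter.1 hy).2
    omega
  have hQsum : ∑ y ∈ Q, weightDegree w S' y ≤ Q.card * (D - 2) := by
    rw [← smul_eq_mul]
    refine Finset.sum_le_card_nsmul _ _ _ fun y hy => ?_
    have h1 := he y (Finset.mem_filter.1 hy).1
    have h2 := (Finset.mem_filter.1 hy).2
    omega
  -- If `r = 0`, the vertices of `N` have degree zero in `S'`, so all weight of `S'` lies inside
  -- `Q`.
  have hQsum0 : r = 0 → ∑ y ∈ Q, weightDegree w S' y ≤ Q.card * (2 * (Q.card - 1)) := by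
    intro h0
    rw [← smul_eq_mul]
    refine Finset.sum_le_card_nsmul _ _ _ fun y hy => ?_
    have hyS' := (Finset.mem_filter.1 hy).1
    calc weightDegree w S' y = ∑ z ∈ Q.erase y, w y z := by
          refine (Finset.sum_subset ((Finset.erase_subset _ _).trans (Finset.filter_subset _ _))
            fun z hz hzQ => ?_).symm
          by_cases hzy : z = y
          · rw [hzy, hself]
          · have hzN : w x z ≤ 1 := by
              by_contra h
              exact hzQ (Finset.mem_erase.2 ⟨hzy, Finset.mem_filter.2 ⟨hz, h⟩⟩)
            have h1 := hr z hz hzN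
            have h2 : w z y ≤ weightDegree w S' z :=
              Finset.single_le_sum (f := w z) (fun _ _ => Nat.zero_le _) hyS'
            have h3 := hcomm y z
            omega
      _ ≤ (Q.erase y).card * 2 := by
          rw [← smul_eq_mul]
          exact Finset.sum_le_card_nsmul _ _ _ fun z _ => hle y z
      _ = 2 * (Q.card - 1) := by rw [Finset.card_erase_of_mem hy, mul_comm]
  generalize Q.card = q at *
  generalize N.card = m at *
  -- From `T ≤ 3 * n - 7` one gets `r + D ≤ 5`, and `2 * q ≤ D`. In each of the finitely many cases
  -- the degree sums over `N` and `Q` are too small for the total of `S'`, which is `2 * (T - D)`.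
  have hD5 : D ≤ 5 := by omega
  have hr5 : r ≤ 5 := by omega
  have hq2 : q ≤ 2 := by omega
  clear_value D n
  interval_cases D <;> interval_cases r <;> interval_cases q <;> omega

/-- Removing a vertex of maximum degree together with any other one leaves no vertex that is
separated from all the others. -/
theorem not_isolated_erase_erase (hcomm : ∀ x y, w x y = w y x) (hself : ∀ x, w x x = 0)
    (hS : 7 ≤ S.card) (hT : weightTotal w S + 14 ≤ 6 * S.card) {x y : V}
    (hx : x ∈ S) (hy : y ∈ S) (hxy : x ≠ y)
    (hmax : ∀ z ∈ S, weightDegree w S z ≤ weightDegree w S x) :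
    ∀ z ∈ (S.erase x).erase y, ∃ t ∈ (S.erase x).erase y, t ≠ z ∧ w z t ≤ 1 := by
  intro z hz
  by_contra! hcon
  have hzy := Finset.ne_of_mem_erase hz
  have hzx := Finset.ne_of_mem_erase (Finset.mem_of_mem_erase hz)
  have hzS := Finset.mem_of_mem_erase (Finset.mem_of_mem_erase hz)
  have hy' : y ∈ S.erase x := Finset.mem_erase.2 ⟨hxy.symm, hy⟩
  -- Such a `z` has degree at least `2 * (n - 3) + w z x`, and `x` at least as much. Together they
  -- carry weight at least `4 * (n - 3)`, which exceeds `3 * n - 7` for `n ≥ 7`.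
  have h1 := Finset.card_erase_of_mem hx
  have h2 := Finset.card_erase_of_mem hy'
  have h3 := Finset.card_erase_of_mem hz
  have h4 : (((S.erase x).erase y).erase z).card * 2
      ≤ weightDegree w (((S.erase x).erase y).erase z) z := by
    rw [← smul_eq_mul]
    exact Finset.card_nsmul_le_sum _ _ _ fun t ht =>
      hcon t (Finset.mem_of_mem_erase ht) (Finset.ne_of_mem_erase ht)
  have h5 := weightDegree_erase (w := w) z hx
  have h6 := weightDegree_erase (w := w) z hy'
  have h7 := weightDegree_erase (w := w) z hz
  have h8 := hmax z hzS
  have h9 := weightTotal_erase_erase hcomm hself hx hzS hzx.symm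
  rw [hcomm x z] at h9
  omega

/-- The six pairs form three perfect matchings. If each contained a pair of weight at least two, the
weight would be at least six, but it is at most five. -/
theorem exists_isTiling_of_card_eq_four (hcomm : ∀ x y, w x y = w y x)
    (hself : ∀ x, w x x = 0) (hS : S.card = 4) (hT : weightTotal w S + 14 ≤ 6 * S.card) :
    ∃ M, IsTiling w S M := by
  obtain ⟨a, b, c, d, hab, hac, had, hbc, hbd, hcd, rfl⟩ := Finset.card_eq_four.1 hS
  have hsum : weightTotal w {a, b, c, d}
      = 2 * (w a b + w a c + w a d + w b c + w b d + w c d) := by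
    simp [weightTotal, weightDegree, Finset.sum_insert, hab, hac, had, hbc, hbd, hcd, hself]
    rw [hcomm b a, hcomm c a, hcomm d a, hcomm c b, hcomm d b, hcomm d c]
    ring
  have key : ∀ x y z t : V, x ≠ y → x ≠ z → x ≠ t → y ≠ z → y ≠ t → z ≠ t →
      ({a, b, c, d} : Finset V) = {x, y, z, t} → w x y ≤ 1 → w z t ≤ 1 →
      ∃ M, IsTiling w ({a, b, c, d} : Finset V) M := by
    intro x y z t hxy hxz hxt hyz hyt hzt heq h1 h2
    rw [heq]
    refine ⟨[[x, y], [z, t]], IsTiling.cons_pair (by simp) (by simp) hxy h1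
      (IsTiling.cons_pair ?_ ?_ hzt h2 ?_)⟩
    · simp [hxz.symm, hyz.symm]
    · simp [hxt.symm, hyt.symm]
    · convert isTiling_empty
      ext u
      simp only [Finset.mem_erase, Finset.mem_insert, Finset.mem_singleton, Finset.notMem_empty]
      tauto
  by_cases h1 : w a b ≤ 1 ∧ w c d ≤ 1
  · exact key a b c d hab hac had hbc hbd hcd rfl h1.1 h1.2
  by_cases h2 : w a c ≤ 1 ∧ w b d ≤ 1
  · exact key a c b d hac hab had hbc.symm hcd hbd
      (by grind) h2.1 h2.2
  by_cases h3 : w a d ≤ 1 ∧ w b c ≤ 1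
  · exact key a d b c had hab hac hbd.symm hcd.symm hbc
      (by grind) h3.1 h3.2
  rw [hS, hsum] at hT
  omega

/-- The degrees sum to at most four, so some vertex has degree at most one and can serve as the
middle of the triple. -/
theorem exists_isTiling_of_card_eq_three (hself : ∀ x, w x x = 0)
    (hS : S.card = 3) (hT : weightTotal w S + 14 ≤ 6 * S.card) :
    ∃ M, IsTiling w S M := by
  obtain ⟨v, hv, hdeg⟩ : ∃ v ∈ S, weightDegree w S v ≤ 1 := by
    by_contra! hcon
    have : S.card * 2 ≤ weightTotal w S := Finset.card_nsmul_le_sum S (weightDegree w S) 2 hcon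
    omega
  have hc : (S.erase v).card = 2 := by rw [Finset.card_erase_of_mem hv, hS]
  obtain ⟨a, b, hab, heq⟩ := Finset.card_eq_two.1 hc
  have ha : a ∈ S.erase v := by simp [heq]
  have hb : b ∈ S.erase v := by simp [heq]
  have hd : weightDegree w S v = w v a + w v b := by
    rw [weightDegree_erase v hv, hself, add_zero, heq, weightDegree, Finset.sum_pair hab]
  refine ⟨[[a, v, b]], IsTiling.cons_triple (Finset.mem_of_mem_erase ha) hv
    (Finset.mem_of_mem_erase hb) (Finset.ne_of_mem_erase ha).symm
    (Finset.ne_of_mem_erase hb).symm hab (by rw [hS]; decide) (by omega) ?_⟩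
  convert isTiling_empty
  rw [heq]
  ext u
  simp only [Finset.mem_erase, Finset.mem_insert, Finset.mem_singleton, Finset.notMem_empty]
  tauto

/-- A set of at least three vertices with weight at most `3 * n - 7` can be tiled, unless it has
at least five vertices and one of them is separated from all the others. -/
theorem exists_isTiling (hcomm : ∀ x y, w x y = w y x) (hself : ∀ x, w x x = 0)
    (hle : ∀ x y, w x y ≤ 2) (n : ℕ) : ∀ S : Finset V, S.card = n → 3 ≤ n →
    weightTotal w S + 14 ≤ 6 * S.card →
    (5 ≤ n → ∀ x ∈ S, ∃ y ∈ S, y ≠ x ∧ w x y ≤ 1) → ∃ M, IsTiling w S M := by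
  induction n using Nat.strong_induction_on with
  | _ n ih =>
    intro S hS hn hT hiso
    rcases Nat.lt_or_ge n 5 with h5 | h5
    · interval_cases n
      · exact exists_isTiling_of_card_eq_three hself hS hT
      · exact exists_isTiling_of_card_eq_four hcomm hself hS hT
    · obtain ⟨x, hx, hmax⟩ := Finset.exists_max_image S (weightDegree w S)
        (Finset.card_pos.1 (by omega))
      obtain ⟨y, hy, hyx, hw, hT'⟩ := exists_partner hcomm hself hle (by omega) hT hx hmax
        (hiso h5 x hx)
      have h1 := Finset.card_erase_of_mem hx
      have h2 := Finset.card_erase_of_mem (Finset.mem_erase.2 ⟨hyx, hy⟩)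
      obtain ⟨M, hM⟩ := ih (n - 2) (by omega) ((S.erase x).erase y) (by omega) (by omega)
        (by omega) fun h7 => not_isolated_erase_erase hcomm hself (by omega) hT hx hy hyx.symm hmax
      exact ⟨_, hM.cons_pair hx hy hyx.symm hw⟩

end TilingExistence

/-! ### Tilings that hide a given pair, for odd `n` and weight at most `2 * n - 4`. -/

section HiddenPair

open EdgeColoredMultigraph

variable {V : Type*} [DecidableEq V] {w : V → V → ℕ} {S : Finset V}

omit [DecidableEq V] in
theorem weightTotal_mono {S' : Finset V} (h : S' ⊆ S) : weightTotal w S' ≤ weightTotal w S :=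
  (Finset.sum_le_sum fun x _ => weightDegree_mono h x).trans (Finset.sum_le_sum_of_subset h)

omit [DecidableEq V] in
theorem weightDegree_le_weightTotal {x : V} (hx : x ∈ S) :
    weightDegree w S x ≤ weightTotal w S :=
  Finset.single_le_sum (f := weightDegree w S) (fun _ _ => Nat.zero_le _) hx

omit [DecidableEq V] in
theorem le_weightDegree {x y : V} (hy : y ∈ S) : w x y ≤ weightDegree w S x :=
  Finset.single_le_sum (f := w x) (fun _ _ => Nat.zero_le _) hy

omit [DecidableEq V] in
theorem weightDegree_le (hle : ∀ x y, w x y ≤ 2) (S : Finset V) (x : V) :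
    weightDegree w S x ≤ S.card * 2 := by
  rw [← smul_eq_mul]
  exact Finset.sum_le_card_nsmul _ _ _ fun y _ => hle x y

theorem exists_isTiling_of_weightTotal_eq_zero (hcomm : ∀ x y, w x y = w y x)
    (hself : ∀ x, w x x = 0) (hle : ∀ x y, w x y ≤ 2) (hS : 2 ≤ S.card)
    (hT : weightTotal w S = 0) : ∃ M, IsTiling w S M := by
  have h0 : ∀ x ∈ S, ∀ y ∈ S, w x y = 0 := fun x hx y hy => by
    have h1 := weightDegree_le_weightTotal (w := w) hx
    have h2 := le_weightDegree (w := w) (x := x) hy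
    omega
  rcases Nat.lt_or_ge S.card 3 with h3 | h3
  · obtain ⟨x, y, hxy, rfl⟩ := Finset.card_eq_two.1 (show S.card = 2 by omega)
    refine ⟨[[x, y]], IsTiling.cons_pair (by simp) (by simp) hxy
      (by rw [h0 x (by simp) y (by simp)]; omega) ?_⟩
    convert isTiling_empty
    ext u
    simp only [Finset.mem_erase, Finset.mem_insert, Finset.mem_singleton, Finset.notMem_empty]
    tauto
  · refine exists_isTiling hcomm hself hle _ S rfl h3 (by omega) fun _ x hx => ?_
    obtain ⟨y, hy, hyx⟩ := Finset.exists_mem_ne (show 1 < S.card by omega) x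
    exact ⟨y, hy, hyx, by rw [h0 x hx y hy]; omega⟩

/-- A vertex of degree at most `n - 2` is the middle of the triple of some tiling, with few
exceptions. -/
theorem exists_isTiling_middle (hcomm : ∀ x y, w x y = w y x)
    (hself : ∀ x, w x x = 0) (hle : ∀ x y, w x y ≤ 2) (hS : 5 ≤ S.card) (hodd : Odd S.card)
    (hT : weightTotal w S + 8 ≤ 4 * S.card) {u : V} (hu : u ∈ S)
    (hd : weightDegree w S u + 2 ≤ S.card) :
    (∃ a b M, IsTiling w S ([a, u, b] :: M)) ∨ (weightDegree w S u = 0 ∧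
      (S.card = 5 ∨ ∃ z ∈ S, weightDegree w S z + 4 = 2 * S.card)) := by
  have hc := Finset.card_erase_of_mem hu
  have htot := weightTotal_erase hcomm hself hu
  have hdu := weightDegree_erase (w := w) u hu
  rw [hself, add_zero] at hdu
  -- If the other vertices can be tiled, `u` fits into one of the pairs. Otherwise either `n = 5`
  -- and removing `u` saves no weight, or some `z` is separated from all vertices but `u`; then `z`
  -- already carries the whole weight `2 * n - 4`.
  by_cases htile : ∃ M, IsTiling w (S.erase u) M
  · obtain ⟨M, hM⟩ := htile
    exact Or.inl (hM.exists_insert hu hodd (by omega))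
  · right
    obtain ⟨m, hm⟩ := hodd
    rcases Nat.lt_or_ge S.card 7 with h7 | h7
    · have h5 : S.card = 5 := by omega
      refine ⟨?_, Or.inl h5⟩
      by_contra hne
      exact htile (exists_isTiling hcomm hself hle _ _ rfl (by omega) (by omega) (by omega))
    · obtain ⟨z, hz, hcon⟩ : ∃ z ∈ S.erase u, ∀ t ∈ S.erase u, t ≠ z → 1 < w z t := by
        by_contra! hcon
        exact htile (exists_isTiling hcomm hself hle _ _ rfl (by omega) (by omega)
          fun _ => hcon)
      have hzS := Finset.mem_of_mem_erase hz
      have hzu := Finset.ne_of_mem_erase hz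
      have h1 : ((S.erase u).erase z).card * 2 ≤ weightDegree w ((S.erase u).erase z) z := by
        rw [← smul_eq_mul]
        exact Finset.card_nsmul_le_sum _ _ _ fun t ht =>
          hcon t (Finset.mem_of_mem_erase ht) (Finset.ne_of_mem_erase ht)
      have h2 := Finset.card_erase_of_mem hz
      have h3 := weightDegree_erase (w := w) z hu
      have h4 := weightDegree_erase (w := w) z hz
      have h5 := weightTotal_erase hcomm hself hzS
      have h6 := weightDegree_erase (w := w) u hzS
      have h7 : weightDegree w (S.erase z) u ≤ weightTotal w (S.erase z) :=
        weightDegree_le_weightTotal (Finset.mem_erase.2 ⟨hzu.symm, hu⟩)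
      have h8 := hcomm z u
      exact ⟨by omega, Or.inr ⟨z, hzS, by omega⟩⟩

omit [DecidableEq V] in
theorem EdgeColoredMultigraph.IsHidden.symm {M : List (List V)} {x y : V} (h : IsHidden M x y) : IsHidden M y x := by
  rcases h with ⟨u, hu, hx, hy⟩ | h | h
  · exact Or.inl ⟨u, hu, hy, hx⟩
  · exact Or.inr (Or.inr h)
  · exact Or.inr (Or.inl h)

/-- The degrees of `x` and `y` sum to at least `2 * n - 2`, so `w x y = 2` and no weight avoids
both. Only `2 * n - 6` goes from them to the other `n - 2` vertices, so some `z` can be the middle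
of a triple with ends `x` and `y`; the rest has weight zero. -/
theorem exists_isTiling_isHidden_of_large (hcomm : ∀ x y, w x y = w y x)
    (hself : ∀ x, w x x = 0) (hle : ∀ x y, w x y ≤ 2) (hS : 5 ≤ S.card) (hodd : Odd S.card)
    (hT : weightTotal w S + 8 ≤ 4 * S.card) {x y : V} (hx : x ∈ S) (hy : y ∈ S) (hxy : x ≠ y)
    (hdx : S.card ≤ weightDegree w S x + 1) (hdy : S.card ≤ weightDegree w S y + 1) :
    ∃ M, IsTiling w S M ∧ IsHidden M x y := by
  have h1 := weightTotal_erase_erase hcomm hself hx hy hxy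
  have h2 := hle x y
  have hy' : y ∈ S.erase x := Finset.mem_erase.2 ⟨hxy.symm, hy⟩
  have hx' : x ∈ S.erase y := Finset.mem_erase.2 ⟨hxy, hx⟩
  have h3 := Finset.card_erase_of_mem hx
  have h4 := Finset.card_erase_of_mem hy'
  have h5 := weightDegree_erase (w := w) x hx
  have h6 := weightDegree_erase (w := w) x hy'
  have h7 := weightDegree_erase (w := w) y hx
  have h8 := weightDegree_erase (w := w) y hy'
  have h9 := hcomm x y
  rw [hself] at h5 h8
  obtain ⟨z, hz, hlt⟩ : ∃ z ∈ (S.erase x).erase y, w z x + w z y ≤ 1 := by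
    by_contra! hcon
    have h10 := Finset.card_nsmul_le_sum _ _ 2 hcon
    simp only [hcomm _ x, hcomm _ y] at h10
    rw [Finset.sum_add_distrib, smul_eq_mul] at h10
    change _ ≤ weightDegree w _ x + weightDegree w _ y at h10
    omega
  have hzy := Finset.ne_of_mem_erase hz
  have hzx := Finset.ne_of_mem_erase (Finset.mem_of_mem_erase hz)
  have hzS := Finset.mem_of_mem_erase (Finset.mem_of_mem_erase hz)
  have heq : ((S.erase z).erase x).erase y = ((S.erase x).erase y).erase z := by
    rw [Finset.erase_right_comm (a := z), Finset.erase_right_comm (a := z)]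
  have hcard := Finset.card_erase_of_mem hz
  obtain ⟨m, hm⟩ := hodd
  obtain ⟨M, hM⟩ := exists_isTiling_of_weightTotal_eq_zero (S := ((S.erase z).erase x).erase y)
    hcomm hself hle (by rw [heq]; omega) (by
      have := weightTotal_mono (w := w) (Finset.erase_subset z ((S.erase x).erase y))
      rw [heq]
      omega)
  exact ⟨_, hM.cons_triple hx hzS hy hzx hzy hxy ⟨m, hm⟩ hlt,
    Or.inl ⟨_, List.mem_cons_self, by simp, by simp⟩⟩

/-- The pair `[x, y]` is itself a segment. Removing it leaves weight at most `n - 3`, too little to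
obstruct a tiling of the rest. -/
theorem exists_isTiling_isHidden_of_zero_of_large (hcomm : ∀ x y, w x y = w y x)
    (hself : ∀ x, w x x = 0) (hle : ∀ x y, w x y ≤ 2) (hS : 5 ≤ S.card)
    (hT : weightTotal w S + 8 ≤ 4 * S.card) {x y : V} (hx : x ∈ S) (hy : y ∈ S) (hxy : x ≠ y)
    (hdx : weightDegree w S x = 0) (hdy : S.card ≤ weightDegree w S y + 1) :
    ∃ M, IsTiling w S M ∧ IsHidden M x y := by
  have h1 := weightTotal_erase_erase hcomm hself hx hy hxy
  have h2 := le_weightDegree (w := w) (x := x) hy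
  have hy' : y ∈ S.erase x := Finset.mem_erase.2 ⟨hxy.symm, hy⟩
  have h3 := Finset.card_erase_of_mem hx
  have h4 := Finset.card_erase_of_mem hy'
  obtain ⟨M, hM⟩ := exists_isTiling hcomm hself hle _ ((S.erase x).erase y) rfl (by omega)
    (by omega) fun h7 z hz => by
      by_contra! hcon
      have h5 : (((S.erase x).erase y).erase z).card * 2
          ≤ weightDegree w (((S.erase x).erase y).erase z) z := by
        rw [← smul_eq_mul]
        exact Finset.card_nsmul_le_sum _ _ _ fun t ht =>
          hcon t (Finset.mem_of_mem_erase ht) (Finset.ne_of_mem_erase ht)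
      have h6 := weightDegree_erase (w := w) z hz
      have h8 := weightTotal_erase hcomm hself hz
      have h9 := Finset.card_erase_of_mem hz
      omega
  exact ⟨_, hM.cons_pair hx hy hxy (by omega), Or.inl ⟨_, List.mem_cons_self, by simp, by simp⟩⟩

/-- For `n = 5`, `x` is put between any two further vertices and `y` is paired with the last. For `n
> 2`, the alternative is impossible: `z` has no weight to `x` or `y`, so its degree is at most `2 *
(n - 3)`. -/
theorem exists_isTiling_isHidden_of_zero_of_zero (hcomm : ∀ x y, w x y = w y x)
    (hself : ∀ x, w x x = 0) (hle : ∀ x y, w x y ≤ 2) {x y : V} (hx : x ∈ S) (hy : y ∈ S)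
    (hxy : x ≠ y) (hdx : weightDegree w S x = 0) (hdy : weightDegree w S y = 0)
    (h : S.card = 5 ∨ ∃ z ∈ S, weightDegree w S z + 4 = 2 * S.card) :
    ∃ M, IsTiling w S M ∧ IsHidden M x y := by
  have hy' : y ∈ S.erase x := Finset.mem_erase.2 ⟨hxy.symm, hy⟩
  have h3 := Finset.card_erase_of_mem hx
  have h4 := Finset.card_erase_of_mem hy'
  have hpos := Finset.card_pos.2 ⟨y, hy'⟩
  have hx0 : ∀ z ∈ S, w x z = 0 := fun z hz => by
    have := le_weightDegree (w := w) (x := x) hz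
    omega
  have hy0 : ∀ z ∈ S, w y z = 0 := fun z hz => by
    have := le_weightDegree (w := w) (x := y) hz
    omega
  rcases h with h5 | ⟨z, hz, hdz⟩
  · obtain ⟨a, b, z, hab, haz, hbz, heq⟩ :=
      Finset.card_eq_three.1 (show ((S.erase x).erase y).card = 3 by omega)
    have key : ∀ t ∈ ({a, b, z} : Finset V), t ∈ S ∧ t ≠ x ∧ t ≠ y := by
      intro t ht
      rw [← heq] at ht
      simp only [Finset.mem_erase] at ht
      tauto
    obtain ⟨haS, hax, hay⟩ := key a (by simp)
    obtain ⟨hbS, hbx, hby⟩ := key b (by simp)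
    obtain ⟨hzS, hzx, hzy⟩ := key z (by simp)
    have hM : IsTiling w (((S.erase x).erase a).erase b) [[y, z]] := by
      refine IsTiling.cons_pair ?_ ?_ hzy.symm (by rw [hy0 z hzS]; omega) ?_
      · simp [hay.symm, hby.symm, hxy.symm, hy]
      · simp [haz.symm, hbz.symm, hzx, hzS]
      · convert isTiling_empty
        ext t
        have ht : t ∈ (S.erase x).erase y ↔ t ∈ ({a, b, z} : Finset V) := by rw [heq]
        simp only [Finset.mem_erase, Finset.mem_insert, Finset.mem_singleton,
          Finset.notMem_empty] at ht ⊢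
        tauto
    exact ⟨_, hM.cons_triple haS hx hbS hax.symm hbx.symm hab (by rw [h5]; decide)
      (by rw [hx0 a haS, hx0 b hbS]; omega),
      Or.inr (Or.inl ⟨a, b, List.mem_cons_self⟩)⟩
  · have hcard : 2 < S.card ∨ S.card = 2 := by omega
    rcases hcard with hcard | hcard
    · exfalso
      have hzx : z ≠ x := by
        rintro rfl
        omega
      have hzy : z ≠ y := by
        rintro rfl
        omega
      have hz' : z ∈ (S.erase x).erase y := by simp [hzx, hzy, hz]
      have h5 := weightDegree_erase (w := w) z hx
      have h6 := weightDegree_erase (w := w) z hy'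
      have h7 := weightDegree_erase (w := w) z hz'
      have h8 := weightDegree_le hle (((S.erase x).erase y).erase z) z
      have h9 := Finset.card_erase_of_mem hz'
      have h10 := Finset.card_pos.2 ⟨z, hz'⟩
      rw [hcomm z x, hx0 z hz] at h5
      rw [hcomm z y, hy0 z hz] at h6
      rw [hself] at h7
      omega
    · refine ⟨[[x, y]], IsTiling.cons_pair hx hy hxy (by rw [hx0 y hy]; omega) ?_,
        Or.inl ⟨_, List.mem_cons_self, by simp, by simp⟩⟩
      convert isTiling_empty
      rw [← Finset.card_eq_zero]
      omega

/-- In a set of odd cardinality with weight at most `2 * n - 4`, a given pair of vertices can be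
hidden by a tiling. -/
theorem exists_isTiling_isHidden (hcomm : ∀ x y, w x y = w y x)
    (hself : ∀ x, w x x = 0) (hle : ∀ x y, w x y ≤ 2) (hS : 5 ≤ S.card) (hodd : Odd S.card)
    (hT : weightTotal w S + 8 ≤ 4 * S.card) {x y : V} (hx : x ∈ S) (hy : y ∈ S) (hxy : x ≠ y) :
    ∃ M, IsTiling w S M ∧ IsHidden M x y := by
  have hmid := fun u hu => exists_isTiling_middle hcomm hself hle hS hodd hT (u := u) hu
  rcases Nat.lt_or_ge (weightDegree w S x + 1) S.card with hdx | hdx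
  · rcases hmid x hx hdx with ⟨a, b, M, hM⟩ | ⟨hx0, -⟩
    · exact ⟨_, hM, Or.inr (Or.inl ⟨a, b, List.mem_cons_self⟩)⟩
    · rcases Nat.lt_or_ge (weightDegree w S y + 1) S.card with hdy | hdy
      · rcases hmid y hy hdy with ⟨a, b, M, hM⟩ | ⟨hy0, h⟩
        · exact ⟨_, hM, Or.inr (Or.inr ⟨a, b, List.mem_cons_self⟩)⟩
        · exact exists_isTiling_isHidden_of_zero_of_zero hcomm hself hle hx hy hxy hx0 hy0 h
      · exact exists_isTiling_isHidden_of_zero_of_large hcomm hself hle hS hT hx hy hxy hx0 hdy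
  · rcases Nat.lt_or_ge (weightDegree w S y + 1) S.card with hdy | hdy
    · rcases hmid y hy hdy with ⟨a, b, M, hM⟩ | ⟨hy0, -⟩
      · exact ⟨_, hM, Or.inr (Or.inr ⟨a, b, List.mem_cons_self⟩)⟩
      · obtain ⟨M, hM, hhid⟩ :=
          exists_isTiling_isHidden_of_zero_of_large hcomm hself hle hS hT hy hx hxy.symm hy0 hdx
        exact ⟨M, hM, IsHidden.symm hhid⟩
    · exact exists_isTiling_isHidden_of_large hcomm hself hle hS hodd hT hx hy hxy hdx hdy

end HiddenPair

/-! ### Counting missing edges, and the choice of three colors. -/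

namespace EdgeColoredMultigraph

variable {V : Type*} {c : ℕ}

theorem exists_missing_eq_zero_of_mem_colorsAt {G : EdgeColoredMultigraph V c} {k : Fin c} {x : V}
    (h : k ∈ G.colorsAt x) : ∃ y, y ≠ x ∧ G.missing k x y = 0 := by
  obtain ⟨⟨e, k'⟩, he, hx, rfl⟩ := h
  obtain ⟨y, rfl⟩ := Sym2.mem_iff_exists.1 hx
  refine ⟨y, ?_, by simp [missing, he]⟩
  rintro rfl
  exact G.loopless _ he (Sym2.mk_isDiag_iff.2 rfl)

/-- Three colors with few missing edges that occur at every vertex yield a proper Hamiltonian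
cycle. -/
theorem hasProperHamiltonianCycle_of_three_colors [Fintype V] (G : EdgeColoredMultigraph V c)
    {i j l : Fin c} (hij : i ≠ j) (hil : i ≠ l) (hjl : j ≠ l) (hcard : 4 ≤ Fintype.card V)
    (hcol : ∀ x, j ∈ G.colorsAt x)
    (hi : weightTotal (G.missing i) Finset.univ + 5 ≤ 2 * Fintype.card V)
    (hsum : weightTotal (G.missing i) Finset.univ + weightTotal (G.missing j) Finset.univ
      + weightTotal (G.missing l) Finset.univ + 14 ≤ 6 * Fintype.card V) :
    G.HasProperHamiltonianCycle := by
  classical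
  have hcomm : ∀ x y, G.missingPair j l x y = G.missingPair j l y x := fun x y => by
    rw [missingPair, missingPair, G.missing_comm j, G.missing_comm l]
  have hself : ∀ x, G.missingPair j l x x = 0 := fun x => by
    rw [missingPair, missing_self, missing_self]
  have hle : ∀ x y, G.missingPair j l x y ≤ 2 := fun x y =>
    Nat.add_le_add (G.missing_le_one j x y) (G.missing_le_one l x y)
  have htot : weightTotal (G.missingPair j l) Finset.univ
      = weightTotal (G.missing j) Finset.univ + weightTotal (G.missing l) Finset.univ := by
    simp only [weightTotal, weightDegree, missingPair, Finset.sum_add_distrib]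
  obtain ⟨t, ht⟩ := even_weightTotal (G.missing_comm i) (G.missing_self i) Finset.univ
  -- In the critical case `n` is odd and exactly `n - 3` edges of color `i` are missing, one more
  -- than `(n - 1) / 2` segments tolerate.
  by_cases hcrit : Odd (Fintype.card V) ∧ 2 * Fintype.card V ≤
      weightTotal (G.missing i) Finset.univ + 6
  · obtain ⟨hodd, hge⟩ := hcrit
    obtain ⟨m, hm⟩ := id hodd
    obtain ⟨x, y, hxy⟩ : ∃ x y, G.missing i x y = 1 := by
      by_contra! hcon
      have : weightTotal (G.missing i) Finset.univ = 0 := by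
        refine Finset.sum_eq_zero fun x _ => Finset.sum_eq_zero fun y _ => ?_
        have h1 := hcon x y
        have h2 := G.missing_le_one i x y
        omega
      omega
    have hne : x ≠ y := by
      rintro rfl
      simp [missing_self] at hxy
    obtain ⟨M, hM, hhid⟩ := exists_isTiling_isHidden (S := Finset.univ) hcomm hself hle
      (by rw [Finset.card_univ]; omega) hodd (by rw [Finset.card_univ]; omega)
      (Finset.mem_univ x) (Finset.mem_univ y) hne
    have hlen := hM.length
    rw [Finset.card_univ] at hlen
    exact G.hasProperHamiltonianCycle_of_isHidden hij hil hjl hcard hM hxy hhid (by omega)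
  · obtain ⟨M, hM⟩ := exists_isTiling hcomm hself hle (Fintype.card V) Finset.univ
      Finset.card_univ (by omega) (by rw [Finset.card_univ]; omega) fun _ x _ => by
        -- An edge of color `j` at `x` provides a vertex from which `x` is not separated.
        obtain ⟨y, hyx, hy⟩ := exists_missing_eq_zero_of_mem_colorsAt (hcol x)
        have := G.missing_le_one l x y
        exact ⟨y, Finset.mem_univ y, hyx, by rw [missingPair]; omega⟩
    have hlen := hM.length
    rw [Finset.card_univ] at hlen
    refine G.hasProperHamiltonianCycle_of_isTiling hij hil hjl hcard hM ?_
    rw [not_and_or, Nat.not_odd_iff_even] at hcrit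
    rcases hcrit with ⟨m, hm⟩ | hcrit <;> omega

theorem sum_weightTotal_missing [Fintype V] (G : EdgeColoredMultigraph V c) :
    ∑ k, weightTotal (G.missing k) Finset.univ + 2 * G.numEdges
      = c * (Fintype.card V * (Fintype.card V - 1)) := by
  classical
  let T : Finset (Fin c × V × V) := Finset.univ.filter fun t => (s(t.2.1, t.2.2), t.1) ∈ G.edgeSet
  have hT : T.card = 2 * G.numEdges := by
    rw [numEdges, Set.ncard_eq_toFinset_card',
      Finset.card_eq_sum_card_fiberwise (f := fun t : Fin c × V × V => (s(t.2.1, t.2.2), t.1))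
        (t := G.edgeSet.toFinset) (fun t ht => by simpa [T] using ht),
      Finset.sum_const_nat (m := 2), mul_comm]
    rintro ⟨e, k⟩ he
    rw [Set.mem_toFinset] at he
    induction e using Sym2.ind with
    | _ a b =>
      have hab : a ≠ b := by
        rintro rfl
        exact G.loopless _ he (Sym2.mk_isDiag_iff.2 rfl)
      have : T.filter (fun t => (s(t.2.1, t.2.2), t.1) = (s(a, b), k))
          = {(k, a, b), (k, b, a)} := by
        ext ⟨k', x, y⟩
        simp only [T, Finset.mem_filter, Finset.mem_univ, true_and, Prod.mk.injEq, Sym2.eq_iff,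
          Finset.mem_insert, Finset.mem_singleton]
        constructor
        · tauto
        · rintro (⟨rfl, rfl, rfl⟩ | ⟨rfl, rfl, rfl⟩)
          · exact ⟨he, by tauto⟩
          · exact ⟨by rwa [Sym2.eq_swap], by tauto⟩
      rw [this, Finset.card_pair]
      simp [hab]
  have hTsum : T.card = ∑ k, ∑ x, ∑ y, if (s(x, y), k) ∈ G.edgeSet then 1 else 0 := by
    rw [Finset.card_filter, Fintype.sum_prod_type]
    simp only [Fintype.sum_prod_type]
  rw [← hT, hTsum, ← Finset.sum_add_distrib]
  have key : ∀ k : Fin c, weightTotal (G.missing k) Finset.univ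
      + (∑ x, ∑ y, if (s(x, y), k) ∈ G.edgeSet then 1 else 0)
      = Fintype.card V * (Fintype.card V - 1) := by
    intro k
    unfold weightTotal weightDegree
    rw [← Finset.sum_add_distrib, Finset.sum_const_nat (m := Fintype.card V - 1),
      Finset.card_univ]
    intro x _
    rw [← Finset.sum_add_distrib]
    have : ∀ y, (G.missing k x y + if (s(x, y), k) ∈ G.edgeSet then 1 else 0)
        = if x ≠ y then 1 else 0 := by
      intro y
      by_cases hxy : x = y
      · subst hxy
        have : (s(x, x), k) ∉ G.edgeSet := fun h => G.loopless _ h (Sym2.mk_isDiag_iff.2 rfl)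
        simp [missing, this]
      · by_cases he : (s(x, y), k) ∈ G.edgeSet <;> simp [missing, hxy, he]
    simp only [this]
    rw [← Finset.card_filter, Finset.filter_ne, Finset.card_erase_of_mem (Finset.mem_univ x),
      Finset.card_univ]
  rw [Finset.sum_congr rfl fun k _ => key k, Finset.sum_const, Finset.card_univ, Fintype.card_fin,
    smul_eq_mul]

theorem mem_colorsAt_of_rainbowDegree_eq {G : EdgeColoredMultigraph V c}
    (h : G.rainbowDegree = c) (x : V) (k : Fin c) : k ∈ G.colorsAt x := by
  have h1 : c ≤ G.vertexRainbowDegree x := by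
    conv_lhs => rw [← h]
    exact ciInf_le (OrderBot.bddBelow _) x
  have h2 : G.colorsAt x = Set.univ := by
    refine Set.eq_of_subset_of_ncard_le (Set.subset_univ _) ?_
    rw [Set.ncard_univ, Nat.card_fin]
    exact h1
  rw [h2]
  trivial

/-- Three cyclically consecutive terms of some sequence have at most the average sum. -/
theorem exists_three_sum_lt {c : ℕ} (hc : 3 ≤ c) (f : Fin c → ℕ) {b : ℕ} (h : ∑ k, f k < c * b) :
    ∃ i j l, i ≠ j ∧ i ≠ l ∧ j ≠ l ∧ f i + f j + f l < 3 * b := by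
  obtain ⟨c, rfl⟩ : ∃ d, c = d + 3 := ⟨c - 3, by omega⟩
  by_contra! hcon
  have h1 : ∀ i : Fin (c + 3), 3 * b ≤ f i + f (i + 1) + f (i + 2) := by
    intro i
    refine hcon i (i + 1) (i + 2) ?_ ?_ ?_
    · simp
    · intro hi
      have := left_eq_add.1 hi
      simp only [Fin.ext_iff, Fin.val_two, Fin.val_zero] at this
      omega
    · intro hi
      have := add_left_cancel hi
      simp only [Fin.ext_iff, Fin.val_two, Fin.val_one] at this
      omega
  -- Summed over all cyclic windows of length three, each term is counted three times.
  have h2 := Finset.card_nsmul_le_sum Finset.univ _ _ fun i _ => h1 i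
  have h3 : ∀ k : Fin (c + 3), ∑ i, f (i + k) = ∑ i, f i := fun k =>
    Equiv.sum_comp (Equiv.addRight k) f
  rw [Finset.sum_add_distrib, Finset.sum_add_distrib, Finset.card_univ, Fintype.card_fin,
    h3, h3, smul_eq_mul] at h2
  nlinarith

theorem succ_choose_two_mul_two (n : ℕ) : (n + 1).choose 2 * 2 = (n + 1) * n := by
  rw [Nat.choose_two_right]
  exact Nat.div_mul_cancel (even_iff_two_dvd.1 (by
    simpa [mul_comm] using Nat.even_mul_succ_self n))

/-- Rainbow degree `c` and more than `c * (n - 1).choose 2 + c` edges force a proper Hamiltonian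
cycle. -/
theorem hasProperHamiltonianCycle_of_le_numEdges [Fintype V] (hn : 4 ≤ Fintype.card V)
    (hc : 3 ≤ c) (G : EdgeColoredMultigraph V c) (hrd : G.rainbowDegree = c)
    (hm : c * (Fintype.card V - 1).choose 2 + c + 1 ≤ G.numEdges) :
    G.HasProperHamiltonianCycle := by
  classical
  have hcol := mem_colorsAt_of_rainbowDegree_eq hrd
  have hsum := G.sum_weightTotal_missing
  have heven := fun k => even_weightTotal (G.missing_comm k) (G.missing_self k) Finset.univ
  choose f hf using heven
  have hlt : ∑ k, f k < c * (Fintype.card V - 2) := by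
    have h1 : ∑ k, weightTotal (G.missing k) Finset.univ = 2 * ∑ k, f k := by
      rw [Finset.mul_sum]
      exact Finset.sum_congr rfl fun k _ => by rw [hf, two_mul]
    rw [h1] at hsum
    obtain ⟨n, hn'⟩ : ∃ n, Fintype.card V = n + 2 := ⟨Fintype.card V - 2, by omega⟩
    rw [hn'] at hsum hm ⊢
    have h2 := succ_choose_two_mul_two n
    simp only [Nat.add_sub_cancel, show n + 2 - 1 = n + 1 by omega] at *
    nlinarith
  obtain ⟨i, j, l, hij, hil, hjl, h3⟩ := exists_three_sum_lt hc f hlt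
  -- The linking color is the one with fewest missing edges, so that `f i ≤ n - 3`.
  have key : ∀ i j l : Fin c, i ≠ j → i ≠ l → j ≠ l →
      f i + f j + f l < 3 * (Fintype.card V - 2) → f i ≤ f j → f i ≤ f l →
      G.HasProperHamiltonianCycle := by
    intro i j l hij hil hjl h3 h1 h2
    refine G.hasProperHamiltonianCycle_of_three_colors hij hil hjl hn (fun x => hcol x j) ?_ ?_
    · rw [hf]
      omega
    · rw [hf, hf, hf]
      omega
  rcases le_total (f i) (f j) with h1 | h1
  · rcases le_total (f i) (f l) with h2 | h2
    · exact key i j l hij hil hjl h3 h1 h2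
    · exact key l i j hil.symm hjl.symm hij (by omega) h2 (h2.trans h1)
  · rcases le_total (f j) (f l) with h2 | h2
    · exact key j i l hij.symm hjl hil (by omega) h1 h2
    · exact key l i j hil.symm hjl.symm hij (by omega) (h2.trans h1) h2

/-! ### The extremal multigraph. -/

/-- All edges that avoid `x`, and all those that join `x` to `y`, in every color. -/
def pendant (c : ℕ) (x y : V) : EdgeColoredMultigraph V c where
  edgeSet := {e | ¬ e.1.IsDiag ∧ (x ∈ e.1 → e.1 = s(x, y))}
  loopless _ h := h.1

variable {x y : V}

theorem mk_mem_pendant {u v : V} {k : Fin c} : (s(u, v), k) ∈ (pendant c x y).edgeSet ↔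
    u ≠ v ∧ (u = x → v = y) ∧ (v = x → u = y) := by
  change (¬ (s(u, v)).IsDiag ∧ (x ∈ s(u, v) → s(u, v) = s(x, y))) ↔ _
  rw [Sym2.mk_isDiag_iff, Sym2.mem_iff, Sym2.eq_iff]
  grind

theorem exists_mem_pendant (hxy : x ≠ y) {z : V} (hz : z ≠ y) (k : Fin c) :
    (s(z, y), k) ∈ (pendant c x y).edgeSet :=
  mk_mem_pendant.2 ⟨hz, fun _ => rfl, fun h => absurd h.symm hxy⟩

theorem connected_pendant (hc : 0 < c) (hxy : x ≠ y) : (pendant c x y).Connected := by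
  have h : ∀ z, (pendant c x y).underlying.Reachable z y := by
    intro z
    by_cases hz : z = y
    · rw [hz]
    · exact SimpleGraph.Adj.reachable ⟨⟨0, hc⟩, exists_mem_pendant hxy hz _⟩
  exact { preconnected := fun u v => (h u).trans (h v).symm, nonempty := ⟨x⟩ }

theorem rainbowDegree_pendant (hxy : x ≠ y) : (pendant c x y).rainbowDegree = c := by
  have h : ∀ z, (pendant c x y).vertexRainbowDegree z = c := by
    intro z
    have : (pendant c x y).colorsAt z = Set.univ := by
      refine Set.eq_univ_of_forall fun k => ?_
      by_cases hz : z = y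
      · exact ⟨(s(x, y), k), exists_mem_pendant hxy hxy k, by simp [hz], rfl⟩
      · exact ⟨(s(z, y), k), exists_mem_pendant hxy hz k, by simp, rfl⟩
    rw [vertexRainbowDegree, this, Set.ncard_univ, Nat.card_fin]
  have : Nonempty V := ⟨x⟩
  simp only [rainbowDegree, h, ciInf_const]

theorem numEdges_pendant [Fintype V] (hn : 2 ≤ Fintype.card V) (hxy : x ≠ y) :
    (pendant c x y).numEdges = c * (Fintype.card V - 1).choose 2 + c := by
  classical
  have hsum := (pendant c x y).sum_weightTotal_missing
  -- In each color, exactly the edges from `x` to the vertices other than `x` and `y` are missing,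
  -- each counted in both orders.
  have key : ∀ k, weightTotal ((pendant c x y).missing k) Finset.univ
      = 2 * (Fintype.card V - 2) := by
    intro k
    rw [weightTotal_erase (missing_comm _ k) (missing_self _ k) (Finset.mem_univ x)]
    have h1 : weightTotal ((pendant c x y).missing k) (Finset.univ.erase x) = 0 := by
      refine Finset.sum_eq_zero fun u hu => Finset.sum_eq_zero fun v hv => ?_
      have hu' := Finset.ne_of_mem_erase hu
      have hv' := Finset.ne_of_mem_erase hv
      simp only [missing, mk_mem_pendant]
      simp [hu', hv']
    have h2 : weightDegree ((pendant c x y).missing k) Finset.univ x = Fintype.card V - 2 := by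
      have : ∀ v, (pendant c x y).missing k x v
          = if v ∈ (Finset.univ.erase x).erase y then 1 else 0 := by
        intro v
        simp only [missing, mk_mem_pendant, Finset.mem_erase, Finset.mem_univ, and_true]
        refine if_congr ?_ rfl rfl
        grind
      simp only [weightDegree, this]
      rw [Finset.sum_boole, Finset.filter_mem_eq_inter, Finset.univ_inter,
        Finset.card_erase_of_mem (by simp [hxy.symm]), Finset.card_erase_of_mem (by simp),
        Finset.card_univ]
      simp [Nat.sub_sub]
    rw [h1, h2, zero_add]
  rw [Finset.sum_congr rfl fun k _ => key k, Finset.sum_const, Finset.card_univ, Fintype.card_fin,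
    smul_eq_mul] at hsum
  obtain ⟨n, hn'⟩ : ∃ n, Fintype.card V = n + 2 := ⟨Fintype.card V - 2, by omega⟩
  rw [hn'] at hsum ⊢
  have h2 := succ_choose_two_mul_two n
  simp only [Nat.add_sub_cancel, show n + 2 - 1 = n + 1 by omega] at *
  nlinarith

/-- Both neighbors of `x` on the cycle would be `y`, but they are distinct since the cycle has at
least three vertices. -/
theorem not_hasProperHamiltonianCycle_pendant [Fintype V] :
    ¬ (pendant c x y).HasProperHamiltonianCycle := by
  rintro ⟨hn, v, col, hv, hedge, -⟩
  obtain ⟨i, hi⟩ := hv.2 x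
  have h1 : v (i + 1) = y := (mk_mem_pendant.1 (hedge i)).2.1 hi
  have h2 : v (i - 1) = y := by
    have := hedge (i - 1)
    rw [sub_add_cancel] at this
    exact (mk_mem_pendant.1 this).2.2 hi
  have h3 : i + 1 = i - 1 := hv.1 (h1.trans h2.symm)
  have h4 : ((2 : ℕ) : ZMod (Fintype.card V)) = 0 := by
    push_cast
    linear_combination h3
  rw [ZMod.natCast_eq_zero_iff] at h4
  have := Nat.le_of_dvd (by omega) h4
  omega

end EdgeColoredMultigraph

theorem theorem5 {V : Type*} [Fintype V] (hn : 4 ≤ Fintype.card V) {c : ℕ} (hc : 3 ≤ c) :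
    (∀ G : EdgeColoredMultigraph V c,
      G.rainbowDegree = c →
      c * (Fintype.card V - 1).choose 2 + c + 1 ≤ G.numEdges →
      G.HasProperHamiltonianCycle) ∧
    (∃ G : EdgeColoredMultigraph V c,
      G.Connected ∧
      G.rainbowDegree = c ∧
      G.numEdges = c * (Fintype.card V - 1).choose 2 + c ∧
      ¬ G.HasProperHamiltonianCycle) := by
  refine ⟨EdgeColoredMultigraph.hasProperHamiltonianCycle_of_le_numEdges hn hc, ?_⟩
  obtain ⟨x, y, hxy⟩ := Fintype.exists_pair_of_one_lt_card (show 1 < Fintype.card V by omega)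
  exact ⟨EdgeColoredMultigraph.pendant c x y,
    EdgeColoredMultigraph.connected_pendant (by omega) hxy,
    EdgeColoredMultigraph.rainbowDegree_pendant hxy,
    EdgeColoredMultigraph.numEdges_pendant (by omega) hxy,
    EdgeColoredMultigraph.not_hasProperHamiltonianCycle_pendant⟩
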